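/- **Trees and queries.** All trees are finite, binary, rooted, ordered and full (every node is a leaf or has exactly a first and a second child); $|T|$ is the number of nodes of $T$ and $\mathrm{h}(T)$ is the number of edges on a longest root-to-leaf path. Let $\Gamma$ be a finite set. A $\Gamma$-tree is a tree with a labeling $\lambda$ that maps each node to a subset of $\Gamma$. An MSO query $Q(X_1,\dots,X_m)$ on $\Gamma$-trees is a monadic second-order formula, with free variables the set variables $X_1,\dots,X_m$, over equality, the first-child and second-child relations $E_1,E_2$, and the unary predicates $P_l$ ($l\in\Gamma$) with $P_l(n)\iff l\in\lambda(n)$. Its output $Q(\lambda(T))$ on $(T,\lambda)$ is the set of all assignments $\{\langle X_i:n\rangle \mid n\in B_i\}$ such that $(T,\lambda)\models Q(B_1,\dots,B_m)$. **Circuits.** A circuit is a finite directed acyclic graph of typed gates with an output gate; the inputs of $g$ are the gates with a wire to $g$, and the fan-in of $g$ is the number of its inputs. The dependency size is the maximum over gates $g$ of the number of gates to which $g$ has a directed path (including $g$ itself). A *set-valued circuit* has gates of type $\mathrm{svar}$ (variables, fan-in $0$), $\cup$, and $\times$ (fan-in $0$ or $2$). A gate $g$ captures a set $S(g)$ of sets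 of variables: $S(g)=\{\{g\}\}$ for a variable; $S(g)$ is the union of the sets captured by the inputs for a $\cup$-gate; for a $\times$-gate, $S(g)=\{\emptyset\}$ if it has no inputs, and $S(g)=\{s_1\cup s_2 \mid s_1\in S(g_1), s_2\in S(g_2)\}$ if its inputs are $g_1,g_2$. The circuit is a *d-DNNF* if for every $\times$-gate no variable has directed paths to two distinct inputs of the gate, and for every $\cup$-gate any two distinct inputs capture disjoint sets. A wire from $g$ to $g'$ is *pure* if $g'$ is a $\cup$-gate, or $g'$ is a $\times$-gate whose other input $g''$ satisfies $\emptyset\in S(g'')$; the circuit is *upwards-deterministic* if every gate has at most one outgoing pure wire. A *hybrid circuit* $C$ has Boolean gates, of type $\mathrm{bvar}$ (Boolean variables, fan-in $0$), $\land$, $\lor$ (only Boolean inputs), $\neg$ (exactly one input, which is Boolean), and set-valued gates, of type $\mathrm{svar}$ (fan-in $0$), $\cup$ (only set-valued inputs), $\times$ (fan-in $0$ or $2$, only set-valued inputs), $\boxtimes$ (exactly two inputs, one set-valued and one Boolean); its output gate is set-valued. Given a valuation $\nu$ of the Boolean variables by $0$ and $1$, each Boolean gate gets a value as usual. The evaluation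 $\nu(C)$ is the set-valued circuit obtained by replacing each Boolean gate by a $\times$-gate without inputs if its value is $1$ and by a $\cup$-gate without inputs if its value is $0$, and turning each $\boxtimes$-gate into a $\times$-gate. The set captured by $C$ under $\nu$ is the set captured by the output gate in $\nu(C)$. A hybrid circuit is a d-DNNF, resp. upwards-deterministic, if $\nu(C)$ is so for every valuation $\nu$. A hybrid circuit $C$ is a *provenance circuit* of $Q$ on an unlabeled tree $T$ if its set-valued variables are exactly the $\langle X_i:n\rangle$ with $1\le i\le m$ and $n\in T$, its Boolean variables are exactly the $\langle l:n\rangle$ with $l\in\Gamma$ and $n\in T$ (one gate for each), and, for every set $\alpha$ of pairs $\langle l:n\rangle$, the set captured by $C$ under the valuation $\nu_\alpha$ that maps $\langle l:n\rangle$ to $1$ if and only if $\langle l:n\rangle\in\alpha$ is exactly $Q(\lambda_\alpha(T))$, where $\lambda_\alpha(n)=\{l\in\Gamma\mid\langle l:n\rangle\in\alpha\}$. **Theorem.** For every finite set $\Gamma$ and every MSO query $Q(X_1,\dots,X_m)$ on $\Gamma$-trees there are constants $c_1,c_2,c_3$ and a program of a random access machine with uniform cost measure such that, given any unlabeled tree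 $T$ (as the list of the children of each node, for an arbitrary numbering of the nodes), the program computes in at most $c_1\cdot|T|$ steps a hybrid circuit $C$ (written as the list of its gates with their types and inputs) that is a provenance circuit of $Q$ on $T$, is a d-DNNF, is upwards-deterministic, has maximal fan-in at most $c_2$, and has dependency size at most $c_3\cdot(\mathrm{h}(T)+1)$. -/

import Mathlib

/-! ## Trees -/

/-- Unlabeled binary, rooted, ordered, full trees: every node is a leaf or has exactly a first
and a second child. -/
inductive FullTree : Type
  | leaf : FullTree
  | node (l r : FullTree) : FullTree

namespace FullTree

/-- The nodes of a tree. -/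
inductive Node : FullTree → Type
  | root (T : FullTree) : Node T
  | left {l r : FullTree} (u : Node l) : Node (FullTree.node l r)
  | right {l r : FullTree} (u : Node r) : Node (FullTree.node l r)

/-- The first and second child of an internal node; `none` on leaves. -/
def Node.children : {T : FullTree} → T.Node → Option (T.Node × T.Node)
  | _, .root .leaf => none
  | _, .root (.node l r) => some (.left (.root l), .right (.root r))
  | _, .left u => u.children.map fun p => (.left p.1, .left p.2)
  | _, .right u => u.children.map fun p => (.right p.1, .right p.2)

/-- The number of nodes. -/
def size : FullTree → ℕ
  | .leaf => 1
  | .node l r => l.size + r.size + 1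

/-- The height: the maximal number of edges on a path from the root to a leaf. -/
def height : FullTree → ℕ
  | .leaf => 0
  | .node l r => max l.height r.height + 1

/-- The input word for `T`, whose nodes are numbered (in any order) by `num`: the number of nodes,
the number of the root, and then, for each node in the order of the numbering, the numbers of its
two children, each increased by one, or `0, 0` if the node is a leaf. -/
def encode (T : FullTree) (num : T.Node ≃ Fin T.size) : List ℕ :=
  T.size :: (num (.root T) : ℕ) ::
    (List.ofFn fun k : Fin T.size =>
      match (num.symm k).children with
      | none => [0, 0]
      | some (u, v) => [(num u : ℕ) + 1, (num v : ℕ) + 1]).flatten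

end FullTree

/-! ## Monadic second-order logic on `Γ`-trees -/

/-- MSO formulas on `Γ`-trees with `f` free first-order and `s` free second-order variables.
A quantifier binds variable number `0` of its body. -/
inductive MSO (Γ : Type*) : ℕ → ℕ → Type _
  | eq {f s : ℕ} (x y : Fin f) : MSO Γ f s
  | child₁ {f s : ℕ} (x y : Fin f) : MSO Γ f s
  | child₂ {f s : ℕ} (x y : Fin f) : MSO Γ f s
  | label {f s : ℕ} (a : Γ) (x : Fin f) : MSO Γ f s
  | mem {f s : ℕ} (x : Fin f) (X : Fin s) : MSO Γ f s
  | not {f s : ℕ} (φ : MSO Γ f s) : MSO Γ f s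
  | and {f s : ℕ} (φ ψ : MSO Γ f s) : MSO Γ f s
  | or {f s : ℕ} (φ ψ : MSO Γ f s) : MSO Γ f s
  | exists₁ {f s : ℕ} (φ : MSO Γ (f + 1) s) : MSO Γ f s
  | forall₁ {f s : ℕ} (φ : MSO Γ (f + 1) s) : MSO Γ f s
  | exists₂ {f s : ℕ} (φ : MSO Γ f (s + 1)) : MSO Γ f s
  | forall₂ {f s : ℕ} (φ : MSO Γ f (s + 1)) : MSO Γ f s

namespace MSO

variable {Γ : Type*} {T : FullTree}

/-- Satisfaction of a formula in the `Γ`-tree `(T, lab)`. -/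
def Sat (lab : T.Node → Set Γ) : {f s : ℕ} → MSO Γ f s →
    (Fin f → T.Node) → (Fin s → Set T.Node) → Prop
  | _, _, .eq x y, v, _ => v x = v y
  | _, _, .child₁ x y, v, _ => ∃ u, (v x).children = some (v y, u)
  | _, _, .child₂ x y, v, _ => ∃ u, (v x).children = some (u, v y)
  | _, _, .label a x, v, _ => a ∈ lab (v x)
  | _, _, .mem x X, v, V => v x ∈ V X
  | _, _, .not φ, v, V => ¬ Sat lab φ v V
  | _, _, .and φ ψ, v, V => Sat lab φ v V ∧ Sat lab ψ v V
  | _, _, .or φ ψ, v, V => Sat lab φ v V ∨ Sat lab ψ v V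
  | _, _, .exists₁ φ, v, V => ∃ n : T.Node, Sat lab φ (Fin.cons n v) V
  | _, _, .forall₁ φ, v, V => ∀ n : T.Node, Sat lab φ (Fin.cons n v) V
  | _, _, .exists₂ φ, v, V => ∃ S : Set T.Node, Sat lab φ v (Fin.cons S V)
  | _, _, .forall₂ φ, v, V => ∀ S : Set T.Node, Sat lab φ v (Fin.cons S V)

/-- The assignment of a tuple `B` of sets of nodes: the set of all singletons `⟨X_i : n⟩`,
written as pairs `(i, n)`, with `n ∈ B i`. -/
def assignment {m : ℕ} (B : Fin m → Set T.Node) : Set (Fin m × T.Node) :=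
  {p | p.2 ∈ B p.1}

/-- The output of a query on a `Γ`-tree: the set of the assignments of its answers. -/
def output {m : ℕ} (Q : MSO Γ 0 m) (lab : T.Node → Set Γ) : Set (Set (Fin m × T.Node)) :=
  {a | ∃ B : Fin m → Set T.Node, Q.Sat lab Fin.elim0 B ∧ a = assignment B}

end MSO

/-! ## Circuits -/

/-- Circuits with gates `G` and gate types `τ`: finite directed acyclic graphs with a
distinguished output gate. `Wire g' g` says that `g'` is an input of `g`. -/
structure Circuit (G τ : Type*) where
  Wire : G → G → Prop
  out : G
  type : G → τ
  finite : Finite G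
  acyclic : ∀ g, ¬ Relation.TransGen Wire g g

namespace Circuit

variable {G τ : Type*} (C : Circuit G τ)

theorem wf : WellFounded C.Wire := by
  have := C.finite
  have : Std.Irrefl (Relation.TransGen C.Wire) := ⟨C.acyclic⟩
  have h : WellFounded (Relation.TransGen C.Wire) :=
    Finite.wellFounded_of_trans_of_irrefl _
  exact Subrelation.wf (fun h => Relation.TransGen.single h) h

/-- The inputs of a gate. -/
def inputs (g : G) : Set G := {g' | C.Wire g' g}

/-- The fan-in of a gate. -/
noncomputable def fanIn (g : G) : ℕ := (C.inputs g).ncard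

/-- The maximal fan-in. -/
noncomputable def maxFanIn : ℕ := ⨆ g, C.fanIn g

/-- The gates that depend on `g`: those to which `g` has a directed path. -/
def dependents (g : G) : Set G := {g' | Relation.ReflTransGen C.Wire g g'}

/-- The dependency size. -/
noncomputable def dependencySize : ℕ := ⨆ g, (C.dependents g).ncard

end Circuit

/-! ### Set-valued circuits -/

/-- The gate types of set-valued circuits; a variable gate carries its name. -/
inductive SetGate (X : Type*)
  | svar (x : X)
  | union
  | times

/-- Set-valued circuits with variables named by `X`. Distinct variable gates have distinct names,
so that variable gates are identified with their names. -/
structure SetCircuit (G X : Type*) extends Circuit G (SetGate X) where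
  svar_unique : ∀ x g g', type g = .svar x → type g' = .svar x → g = g'
  svar_fanIn : ∀ x g, type g = .svar x → toCircuit.fanIn g = 0
  times_fanIn : ∀ g, type g = .times → toCircuit.fanIn g = 0 ∨ toCircuit.fanIn g = 2

namespace SetCircuit

variable {G X : Type*} (C : SetCircuit G X)

/-- The set of assignments captured by a gate, defined bottom-up. -/
def captured : G → Set (Set X) :=
  C.wf.fix fun g ih =>
    match C.type g with
    | .svar x => {{x}}
    | .union => {a | ∃ (g' : G) (h : C.Wire g' g), a ∈ ih g' h}
    | .times =>
      {a | C.inputs g = ∅ ∧ a = ∅} ∪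
      {a | ∃ (g₁ g₂ : G) (h₁ : C.Wire g₁ g) (h₂ : C.Wire g₂ g),
        g₁ ≠ g₂ ∧ ∃ a₁ ∈ ih g₁ h₁, ∃ a₂ ∈ ih g₂ h₂, a = a₁ ∪ a₂}

theorem captured_eq (g : G) :
    C.captured g =
      match C.type g with
      | .svar x => {{x}}
      | .union => {a | ∃ g', C.Wire g' g ∧ a ∈ C.captured g'}
      | .times =>
        {a | C.inputs g = ∅ ∧ a = ∅} ∪
        {a | ∃ g₁ g₂, C.Wire g₁ g ∧ C.Wire g₂ g ∧
          g₁ ≠ g₂ ∧ ∃ a₁ ∈ C.captured g₁, ∃ a₂ ∈ C.captured g₂, a = a₁ ∪ a₂} := by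
  unfold captured
  rw [WellFounded.fix_eq]
  split <;> simp only [exists_prop, exists_and_left]

/-- The variables that have a directed path to `g`. -/
def dom (g : G) : Set X :=
  {x | ∃ g', C.type g' = .svar x ∧ Relation.ReflTransGen C.Wire g' g}

/-- A `×`-gate is decomposable if distinct inputs have disjoint domains. -/
def Decomposable (g : G) : Prop :=
  ∀ g₁ g₂, C.Wire g₁ g → C.Wire g₂ g → g₁ ≠ g₂ → Disjoint (C.dom g₁) (C.dom g₂)

/-- A `∪`-gate is deterministic if distinct inputs capture disjoint sets. -/
def Deterministic (g : G) : Prop :=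
  ∀ g₁ g₂, C.Wire g₁ g → C.Wire g₂ g → g₁ ≠ g₂ → Disjoint (C.captured g₁) (C.captured g₂)

/-- d-DNNF circuits. -/
def IsDDNNF : Prop :=
  (∀ g, C.type g = .times → C.Decomposable g) ∧ (∀ g, C.type g = .union → C.Deterministic g)

/-- The wire from `g` to `g'` is pure if `g'` is a `∪`-gate, or if it is a `×`-gate whose other
input captures the empty assignment. -/
def Pure (g g' : G) : Prop :=
  C.Wire g g' ∧
    (C.type g' = .union ∨
      C.type g' = .times ∧ ∃ g'', C.Wire g'' g' ∧ g'' ≠ g ∧ ∅ ∈ C.captured g'')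

/-- Every gate has at most one outgoing pure wire. -/
def IsUpwardsDeterministic : Prop :=
  ∀ g g₁ g₂, C.Pure g g₁ → C.Pure g g₂ → g₁ = g₂

end SetCircuit

/-! ### Hybrid circuits -/

/-- The gate types of hybrid circuits; a variable gate carries its name. -/
inductive HybridGate (X B : Type*)
  | svar (x : X)
  | bvar (b : B)
  | union
  | times
  | boxtimes
  | and
  | or
  | not

/-- Boolean gate types; the others are set-valued. -/
def HybridGate.IsBoolean {X B : Type*} : HybridGate X B → Prop
  | .bvar _ | .and | .or | .not => True
  | .svar _ | .union | .times | .boxtimes => False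

/-- Hybrid circuits with set-valued variables named by `X` and Boolean variables named by `B`.
Distinct variable gates have distinct names. -/
structure HybridCircuit (G X B : Type*) extends Circuit G (HybridGate X B) where
  svar_unique : ∀ x g g', type g = .svar x → type g' = .svar x → g = g'
  bvar_unique : ∀ b g g', type g = .bvar b → type g' = .bvar b → g = g'
  out_set : ¬ (type out).IsBoolean
  svar_fanIn : ∀ x g, type g = .svar x → toCircuit.fanIn g = 0
  bvar_fanIn : ∀ b g, type g = .bvar b → toCircuit.fanIn g = 0
  and_inputs : ∀ g g', type g = .and → Wire g' g → (type g').IsBoolean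
  or_inputs : ∀ g g', type g = .or → Wire g' g → (type g').IsBoolean
  not_inputs : ∀ g g', type g = .not → Wire g' g → (type g').IsBoolean
  not_fanIn : ∀ g, type g = .not → toCircuit.fanIn g = 1
  union_inputs : ∀ g g', type g = .union → Wire g' g → ¬ (type g').IsBoolean
  times_inputs : ∀ g g', type g = .times → Wire g' g → ¬ (type g').IsBoolean
  times_fanIn : ∀ g, type g = .times → toCircuit.fanIn g = 0 ∨ toCircuit.fanIn g = 2
  boxtimes_inputs : ∀ g, type g = .boxtimes → ∃ g₁ g₂,
    ¬ (type g₁).IsBoolean ∧ (type g₂).IsBoolean ∧ toCircuit.inputs g = {g₁, g₂}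

namespace HybridCircuit

variable {G X B : Type*} (C : HybridCircuit G X B)

/-- `C.bval ν g` says that the Boolean gate `g` has value `1` under the valuation `ν`; it is
defined bottom-up, and is only meaningful on Boolean gates. -/
def bval (ν : B → Bool) : G → Prop :=
  C.wf.fix fun g ih =>
    match C.type g with
    | .bvar b => ν b = true
    | .and => ∀ (g' : G) (h : C.Wire g' g), ih g' h
    | .or => ∃ (g' : G) (h : C.Wire g' g), ih g' h
    | .not => ∃ (g' : G) (h : C.Wire g' g), ¬ ih g' h
    | _ => False

theorem bval_eq (ν : B → Bool) (g : G) :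
    C.bval ν g =
      match C.type g with
      | .bvar b => ν b = true
      | .and => ∀ g', C.Wire g' g → C.bval ν g'
      | .or => ∃ g', C.Wire g' g ∧ C.bval ν g'
      | .not => ∃ g', C.Wire g' g ∧ ¬ C.bval ν g'
      | _ => False := by
  unfold bval
  rw [WellFounded.fix_eq]
  split <;> simp only [exists_prop]

open Classical in
/-- The gate types of the evaluation of `C` under `ν`: Boolean gates of value `1` become
`×`-gates, Boolean gates of value `0` become `∪`-gates, and `⊠`-gates become `×`-gates. -/
noncomputable def evalType (ν : B → Bool) (g : G) : SetGate X :=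
  match C.type g with
  | .svar x => .svar x
  | .union => .union
  | .times => .times
  | .boxtimes => .times
  | .bvar _ | .and | .or | .not => if C.bval ν g then .times else .union

theorem evalType_svar {ν : B → Bool} {g : G} {x : X} (h : C.evalType ν g = .svar x) :
    C.type g = .svar x := by
  unfold evalType at h
  split at h <;> first | (split at h <;> cases h) | (cases h; assumption) | cases h

/-- The evaluation of a hybrid circuit under a valuation. The gates that replace Boolean gates
have no inputs. -/
noncomputable def eval (ν : B → Bool) : SetCircuit G X where
  Wire g' g := C.Wire g' g ∧ ¬ (C.type g).IsBoolean
  out := C.out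
  type := C.evalType ν
  finite := C.finite
  acyclic g h := C.acyclic g (Relation.TransGen.mono (fun _ _ h => h.1) _ _ h)
  svar_unique x g g' h h' := C.svar_unique x g g' (C.evalType_svar h) (C.evalType_svar h')
  svar_fanIn x g h := by
    have h' := C.evalType_svar h
    rw [← C.svar_fanIn x g h']
    simp [Circuit.fanIn, Circuit.inputs, h', HybridGate.IsBoolean]
  times_fanIn g h := by
    by_cases hb : (C.type g).IsBoolean
    · left
      simp [Circuit.fanIn, Circuit.inputs, hb]
    · have e : ({g' | C.Wire g' g ∧ ¬ (C.type g).IsBoolean} : Set G) = C.inputs g := by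
        simp [Circuit.inputs, hb]
      simp only [Circuit.fanIn]
      change ({g' | C.Wire g' g ∧ ¬ (C.type g).IsBoolean} : Set G).ncard = 0 ∨
        ({g' | C.Wire g' g ∧ ¬ (C.type g).IsBoolean} : Set G).ncard = 2
      rw [e]
      cases ht : C.type g with
      | times => exact C.times_fanIn g ht
      | boxtimes =>
        right
        obtain ⟨g₁, g₂, h₁, h₂, h₃⟩ := C.boxtimes_inputs g ht
        rw [h₃]
        exact Set.ncard_pair fun h => h₁ (h ▸ h₂)
      | svar x => simp [evalType, ht] at h
      | union => simp [evalType, ht] at h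
      | bvar b => simp [ht, HybridGate.IsBoolean] at hb
      | and => simp [ht, HybridGate.IsBoolean] at hb
      | or => simp [ht, HybridGate.IsBoolean] at hb
      | not => simp [ht, HybridGate.IsBoolean] at hb

/-- The set of assignments captured by the circuit under a valuation. -/
noncomputable def captured (ν : B → Bool) : Set (Set X) := (C.eval ν).captured C.out

/-- All evaluations are d-DNNFs. -/
def IsDDNNF : Prop := ∀ ν : B → Bool, (C.eval ν).IsDDNNF

/-- All evaluations are upwards-deterministic. -/
def IsUpwardsDeterministic : Prop := ∀ ν : B → Bool, (C.eval ν).IsUpwardsDeterministic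

open Classical in
/-- Provenance circuits of a query on an unlabeled tree: the set-valued variables are exactly the
singletons `⟨X_i : n⟩`, the Boolean variables are exactly the singletons `⟨l : n⟩`, and, for every
labeling assignment `α`, the circuit captures, under the valuation given by `α`, the output
of the query on the tree labeled according to `α`. -/
def IsProvenanceCircuit {Γ : Type*} {m : ℕ} {T : FullTree}
    (C : HybridCircuit G (Fin m × T.Node) (Γ × T.Node)) (Q : MSO Γ 0 m) : Prop :=
  (∀ x, ∃ g, C.type g = .svar x) ∧
  (∀ b, ∃ g, C.type g = .bvar b) ∧
  ∀ α : Set (Γ × T.Node),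
    C.captured (fun b => decide (b ∈ α)) = Q.output (fun n => {l | (l, n) ∈ α})

end HybridCircuit

/-- The three numbers describing a gate type, given a code (a pair of numbers) for each
variable. -/
def HybridGate.encode {X B : Type*} (cX : X → ℕ × ℕ) (cB : B → ℕ × ℕ) :
    HybridGate X B → List ℕ
  | .svar x => [0, (cX x).1, (cX x).2]
  | .bvar b => [1, (cB b).1, (cB b).2]
  | .union => [2, 0, 0]
  | .times => [3, 0, 0]
  | .boxtimes => [4, 0, 0]
  | .and => [5, 0, 0]
  | .or => [6, 0, 0]
  | .not => [7, 0, 0]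

/-- The word `w` describes the circuit `C` on the gates `0, …, N - 1`: it lists the number of gates
and the output gate, and then, for each gate in turn, its type, its fan-in, and its inputs
(without repetition, in any order). -/
def HybridCircuit.IsEncodedBy {N : ℕ} {X B : Type*} (C : HybridCircuit (Fin N) X B)
    (cX : X → ℕ × ℕ) (cB : B → ℕ × ℕ) (w : List ℕ) : Prop :=
  ∃ ins : Fin N → List (Fin N),
    (∀ g, (ins g).Nodup ∧ ∀ g', g' ∈ ins g ↔ C.Wire g' g) ∧
    w = N :: (C.out : ℕ) ::
      (List.ofFn fun g : Fin N =>
        (C.type g).encode cX cB ++ (ins g).length :: (ins g).map fun g' => (g' : ℕ)).flatten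

/-! ## Random access machines with uniform cost -/

namespace RAM

/-- The instructions of a random access machine. Its memory consists of cells `0, 1, 2, …`, each
holding a natural number; it has an input tape, read from left to right, and a write-only
output tape. -/
inductive Instr
  /-- `r_d := k` -/
  | const (d k : ℕ)
  /-- `r_d := r_a` -/
  | move (d a : ℕ)
  /-- `r_d := r_a + r_b` -/
  | add (d a b : ℕ)
  /-- `r_d := max (r_a - r_b) 0` -/
  | sub (d a b : ℕ)
  /-- indirect read: with `i = r_a`, `r_d := r_i` -/
  | load (d a : ℕ)
  /-- indirect write: with `i = r_a`, `r_i := r_b` -/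
  | store (a b : ℕ)
  /-- `r_d :=` the next symbol of the input tape (`0` at the end of the tape) -/
  | read (d : ℕ)
  /-- append `r_a` to the output tape -/
  | write (a : ℕ)
  /-- continue at instruction `l` -/
  | jump (l : ℕ)
  /-- continue at instruction `l` if `r_a = 0` -/
  | jzero (a l : ℕ)

/-- Programs: finite lists of instructions. -/
abbrev Program := List Instr

/-- Configurations. -/
structure Config where
  pc : ℕ
  mem : ℕ → ℕ
  inp : List ℕ
  out : List ℕ

/-- The effect of one instruction. -/
def Instr.exec : Instr → Config → Config
  | .const d k, s => { s with pc := s.pc + 1, mem := Function.update s.mem d k }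
  | .move d a, s => { s with pc := s.pc + 1, mem := Function.update s.mem d (s.mem a) }
  | .add d a b, s =>
    { s with pc := s.pc + 1, mem := Function.update s.mem d (s.mem a + s.mem b) }
  | .sub d a b, s =>
    { s with pc := s.pc + 1, mem := Function.update s.mem d (s.mem a - s.mem b) }
  | .load d a, s => { s with pc := s.pc + 1, mem := Function.update s.mem d (s.mem (s.mem a)) }
  | .store a b, s => { s with pc := s.pc + 1, mem := Function.update s.mem (s.mem a) (s.mem b) }
  | .read d, s =>
    { s with pc := s.pc + 1, mem := Function.update s.mem d (s.inp.headD 0), inp := s.inp.tail }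
  | .write a, s => { s with pc := s.pc + 1, out := s.out ++ [s.mem a] }
  | .jump l, s => { s with pc := l }
  | .jzero a l, s => { s with pc := if s.mem a = 0 then l else s.pc + 1 }

/-- One computation step, of cost one; nothing changes once the machine has halted. -/
def step (P : Program) (s : Config) : Config :=
  match P[s.pc]? with
  | some i => i.exec s
  | none => s

/-- The machine has halted: the program counter has left the program. -/
def Halted (P : Program) (s : Config) : Prop := P.length ≤ s.pc

/-- The initial configuration on an input word, with all memory cells `0`. -/
def init (input : List ℕ) : Config := ⟨0, fun _ => 0, input, []⟩

/-- On the word `input`, the program `P` halts after at most `t` steps, with the word `output` on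
its output tape. -/
def ComputesInTime (P : Program) (input output : List ℕ) (t : ℕ) : Prop :=
  ∃ k ≤ t, Halted P ((step P)^[k] (init input)) ∧ ((step P)^[k] (init input)).out = output

end RAM

/-!
The query is translated into a deterministic bottom-up tree automaton whose letters are the labels
of a node together with the set variables containing it (`MSO.exists_automaton`): Boolean
connectives are complements and products of automata, and quantifiers are projections, by a powerset
construction.

For each node `n` and each state `r` the circuit has a gate `state r` that captures the assignments
to the nodes at and below `n` for which the automaton reaches `r` at `n`. It is a union of gates
`ext β a p q`, one for each transition to `r` from the states `p`, `q` of the children, where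
`a ⊆ Γ` is the label of `n` and `β` the set of indices `i` with `n ∈ X_i`. Such a gate is the
product of a gate `chain β` for the singletons `⟨X_i : n⟩` with `i ∈ β` and of the gate `box a p q`,
which in turn is the product of the gates for `p` and `q` at the children, restricted by a Boolean
gate testing that the label is `a`. The assignment, the labels and the determinism of the automaton
determine `β`, `a`, `p`, `q` (`TreeAutomaton.captures_ext_iff`), so that unions are disjoint;
products are decomposable because they concern disjoint sets of nodes. For the empty assignment in
particular, each node has a single state, and a single choice of `β`, `a`, `p`, `q`; and as the
product for `(p, q)` is built only once and shared by all transitions, each gate has at most one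
outgoing pure wire (`TreeAutomaton.pureTarget_of_pure`). The number of gates for each node is
constant, and wires lead from a node to itself, to its parent or to the output gate, whence the
bounds on fan-in and dependency size.

The gates of node number `k` receive consecutive numbers, starting with `K * k + 1` for a constant
`K`, and the output gate has number `0`. So the description of the gates of a node is a fixed word,
up to the numbers of the node and of its children, and a random access machine can write the circuit
in a single pass over its input, in the order of the numbering and without traversing the tree
(`RAM.computesInTime_templateProgram`).
-/

/-! ### Nodes of full trees -/

namespace FullTree

namespace Node

/-- The height of the subtree rooted at a node. -/
def height : {T : FullTree} → T.Node → ℕ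
  | _, .root T => T.height
  | _, .left u => u.height
  | _, .right u => u.height

/-- The descendants of a node, including the node itself. -/
def desc : {T : FullTree} → T.Node → Set T.Node
  | _, .root _ => Set.univ
  | _, .left u => Node.left '' u.desc
  | _, .right u => Node.right '' u.desc

theorem mem_desc_self : ∀ {T : FullTree} (n : T.Node), n ∈ n.desc
  | _, .root _ => trivial
  | _, .left u => ⟨u, u.mem_desc_self, rfl⟩
  | _, .right u => ⟨u, u.mem_desc_self, rfl⟩

theorem height_lt_of_children : ∀ {T : FullTree} {n u v : T.Node},
    n.children = some (u, v) → u.height < n.height ∧ v.height < n.height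
  | _, .root .leaf, _, _, h => by simp [children] at h
  | _, .root (.node l r), _, _, h => by
    simp only [children, Option.some.injEq, Prod.mk.injEq] at h
    obtain ⟨rfl, rfl⟩ := h
    simp only [height, FullTree.height]
    omega
  | _, .left w, _, _, h => by
    simp only [children, Option.map_eq_some_iff, Prod.mk.injEq] at h
    obtain ⟨⟨u', v'⟩, h, rfl, rfl⟩ := h
    exact (height_lt_of_children h :)
  | _, .right w, _, _, h => by
    simp only [children, Option.map_eq_some_iff, Prod.mk.injEq] at h
    obtain ⟨⟨u', v'⟩, h, rfl, rfl⟩ := h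
    exact (height_lt_of_children h :)

theorem desc_of_children_none : ∀ {T : FullTree} {n : T.Node}, n.children = none → n.desc = {n}
  | _, .root .leaf, _ => by
    ext x
    cases x
    simp [desc]
  | _, .root (.node l r), h => by simp [children] at h
  | _, .left w, h => by
    simp only [children, Option.map_eq_none_iff] at h
    simp [desc, desc_of_children_none h]
  | _, .right w, h => by
    simp only [children, Option.map_eq_none_iff] at h
    simp [desc, desc_of_children_none h]

/-- The descendants of an internal node are the node itself and, disjointly, those of its two
children. -/
theorem desc_of_children : ∀ {T : FullTree} {n u v : T.Node}, n.children = some (u, v) →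
    n.desc = insert n (u.desc ∪ v.desc) ∧ n ∉ u.desc ∧ n ∉ v.desc ∧ Disjoint u.desc v.desc
  | _, .root .leaf, _, _, h => by simp [children] at h
  | _, .root (.node l r), _, _, h => by
    simp only [children, Option.some.injEq, Prod.mk.injEq] at h
    obtain ⟨rfl, rfl⟩ := h
    refine ⟨?_, by simp [desc], by simp [desc], ?_⟩
    · ext x
      cases x <;> simp [desc]
    · rw [Set.disjoint_left]
      rintro _ ⟨x, -, rfl⟩ ⟨y, -, h⟩
      cases h
  | .node l r, .left w, _, _, h => by
    simp only [children, Option.map_eq_some_iff, Prod.mk.injEq] at h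
    obtain ⟨⟨u', v'⟩, h, rfl, rfl⟩ := h
    obtain ⟨h1, h2, h3, h4⟩ := desc_of_children h
    have hi : Function.Injective (Node.left : l.Node → (FullTree.node l r).Node) :=
      fun a b h => by cases h; rfl
    simp only [desc, h1, Set.image_insert_eq, Set.image_union, hi.mem_set_image, h2, h3,
      not_false_eq_true, Set.disjoint_image_iff hi, h4, and_self]
  | .node l r, .right w, _, _, h => by
    simp only [children, Option.map_eq_some_iff, Prod.mk.injEq] at h
    obtain ⟨⟨u', v'⟩, h, rfl, rfl⟩ := h
    obtain ⟨h1, h2, h3, h4⟩ := desc_of_children h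
    have hi : Function.Injective (Node.right : r.Node → (FullTree.node l r).Node) :=
      fun a b h => by cases h; rfl
    simp only [desc, h1, Set.image_insert_eq, Set.image_union, hi.mem_set_image, h2, h3,
      not_false_eq_true, Set.disjoint_image_iff hi, h4, and_self]

theorem desc_trans : ∀ {T : FullTree} {n u w : T.Node}, w ∈ u.desc → u ∈ n.desc → w ∈ n.desc
  | _, .root _, _, _, _, _ => trivial
  | _, .left n, _, _, h, h' => by
    obtain ⟨u, hu, rfl⟩ := h'
    obtain ⟨w, hw, rfl⟩ := h
    exact ⟨w, desc_trans hw hu, rfl⟩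
  | _, .right n, _, _, h, h' => by
    obtain ⟨u, hu, rfl⟩ := h'
    obtain ⟨w, hw, rfl⟩ := h
    exact ⟨w, desc_trans hw hu, rfl⟩

instance (T : FullTree) : Finite T.Node := by
  induction T with
  | leaf =>
    refine Finite.of_surjective (fun _ : Unit => Node.root .leaf) fun u => ?_
    cases u
    exact ⟨(), rfl⟩
  | node l r ihl ihr =>
    refine Finite.of_surjective (fun x : Option (l.Node ⊕ r.Node) =>
      match x with
      | none => Node.root (.node l r)
      | some (.inl u) => .left u
      | some (.inr u) => .right u) fun u => ?_
    cases u with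
    | root => exact ⟨none, rfl⟩
    | left u => exact ⟨some (.inl u), rfl⟩
    | right u => exact ⟨some (.inr u), rfl⟩

/-- A node has at most as many ancestors as a root-to-leaf path has nodes. -/
theorem ncard_ancestors_le : ∀ {T : FullTree} (n : T.Node),
    {n' : T.Node | n ∈ n'.desc}.ncard ≤ T.height + 1
  | T, .root _ => by
    have : {n' : T.Node | Node.root T ∈ n'.desc} ⊆ {Node.root T} := by
      intro n' h
      cases n' with
      | root => rfl
      | left u => obtain ⟨_, -, h⟩ := h; cases h
      | right u => obtain ⟨_, -, h⟩ := h; cases h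
    have h := Set.ncard_le_ncard this
    rw [Set.ncard_singleton] at h
    omega
  | .node l r, .left n => by
    have : {n' : (FullTree.node l r).Node | Node.left n ∈ n'.desc} ⊆
        insert (Node.root _) (Node.left '' {n' | n ∈ n'.desc}) := by
      intro n' h
      cases n' with
      | root => exact .inl rfl
      | left u => obtain ⟨_, h, h'⟩ := h; cases h'; exact .inr ⟨u, h, rfl⟩
      | right u => obtain ⟨_, -, h⟩ := h; cases h
    have h := Set.ncard_le_ncard this
    have h' := Set.ncard_insert_le (Node.root (.node l r)) (Node.left '' {n' | n ∈ n'.desc})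
    have h'' := Set.ncard_image_le (f := (Node.left : l.Node → (FullTree.node l r).Node))
      (s := {n' | n ∈ n'.desc})
    have := ncard_ancestors_le n
    simp only [FullTree.height]
    omega
  | .node l r, .right n => by
    have : {n' : (FullTree.node l r).Node | Node.right n ∈ n'.desc} ⊆
        insert (Node.root _) (Node.right '' {n' | n ∈ n'.desc}) := by
      intro n' h
      cases n' with
      | root => exact .inl rfl
      | right u => obtain ⟨_, h, h'⟩ := h; cases h'; exact .inr ⟨u, h, rfl⟩
      | left u => obtain ⟨_, -, h⟩ := h; cases h
    have h := Set.ncard_le_ncard this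
    have h' := Set.ncard_insert_le (Node.root (.node l r)) (Node.right '' {n' | n ∈ n'.desc})
    have h'' := Set.ncard_image_le (f := (Node.right : r.Node → (FullTree.node l r).Node))
      (s := {n' | n ∈ n'.desc})
    have := ncard_ancestors_le n
    simp only [FullTree.height]
    omega

theorem height_le : ∀ {T : FullTree} (n : T.Node), n.height ≤ T.height
  | _, .root _ => le_rfl
  | .node l r, .left u => by
    have := u.height_le
    simp only [height, FullTree.height]
    omega
  | .node l r, .right u => by
    have := u.height_le
    simp only [height, FullTree.height]
    omega

theorem root_ne_child : ∀ {T : FullTree} {n u v : T.Node}, n.children = some (u, v) →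
    u ≠ root T ∧ v ≠ root T
  | T, n, u, v, h => by
    have h1 := height_lt_of_children h
    have h2 := n.height_le
    constructor <;> rintro rfl <;> simp only [height] at h1 <;> omega

/-- Each node is the child of at most one node. -/
theorem parent_unique {T : FullTree} {n n' u v u' v' w : T.Node} (h : n.children = some (u, v))
    (h' : n'.children = some (u', v')) (hw : w = u ∨ w = v) (hw' : w = u' ∨ w = v') : n = n' := by
  induction n with
  | root T =>
    cases T with
    | leaf => simp [children] at h
    | node l r =>
      simp only [children, Option.some.injEq, Prod.mk.injEq] at h
      obtain ⟨rfl, rfl⟩ := h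
      cases n' with
      | root => rfl
      | left n' =>
        simp only [children, Option.map_eq_some_iff, Prod.mk.injEq] at h'
        obtain ⟨⟨x, y⟩, h', rfl, rfl⟩ := h'
        have := root_ne_child h'
        simp only at hw'
        rcases hw with rfl | rfl <;> simp_all [eq_comm]
      | right n' =>
        simp only [children, Option.map_eq_some_iff, Prod.mk.injEq] at h'
        obtain ⟨⟨x, y⟩, h', rfl, rfl⟩ := h'
        have := root_ne_child h'
        simp only at hw'
        rcases hw with rfl | rfl <;> simp_all [eq_comm]
  | @left l r n ih =>
    simp only [children, Option.map_eq_some_iff, Prod.mk.injEq] at h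
    obtain ⟨⟨x, y⟩, h, rfl, rfl⟩ := h
    have := root_ne_child h
    cases n' with
    | root =>
      simp only [children, Option.some.injEq, Prod.mk.injEq] at h'
      obtain ⟨rfl, rfl⟩ := h'
      rcases hw' with rfl | rfl <;> simp_all [eq_comm]
    | left n' =>
      simp only [children, Option.map_eq_some_iff, Prod.mk.injEq] at h'
      obtain ⟨⟨x', y'⟩, h', rfl, rfl⟩ := h'
      obtain ⟨w, rfl⟩ : ∃ w', w = Node.left w' := by
        rcases hw with rfl | rfl
        exacts [⟨_, rfl⟩, ⟨_, rfl⟩]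
      rw [ih h h' (by simpa using hw) (by simpa using hw')]
    | right n' =>
      simp only [children, Option.map_eq_some_iff, Prod.mk.injEq] at h'
      obtain ⟨⟨x', y'⟩, h', rfl, rfl⟩ := h'
      rcases hw with rfl | rfl <;> simp at hw'
  | @right l r n ih =>
    simp only [children, Option.map_eq_some_iff, Prod.mk.injEq] at h
    obtain ⟨⟨x, y⟩, h, rfl, rfl⟩ := h
    have := root_ne_child h
    cases n' with
    | root =>
      simp only [children, Option.some.injEq, Prod.mk.injEq] at h'
      obtain ⟨rfl, rfl⟩ := h'
      rcases hw' with rfl | rfl <;> simp_all [eq_comm]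
    | right n' =>
      simp only [children, Option.map_eq_some_iff, Prod.mk.injEq] at h'
      obtain ⟨⟨x', y'⟩, h', rfl, rfl⟩ := h'
      obtain ⟨w, rfl⟩ : ∃ w', w = Node.right w' := by
        rcases hw with rfl | rfl
        exacts [⟨_, rfl⟩, ⟨_, rfl⟩]
      rw [ih h h' (by simpa using hw) (by simpa using hw')]
    | left n' =>
      simp only [children, Option.map_eq_some_iff, Prod.mk.injEq] at h'
      obtain ⟨⟨x', y'⟩, h', rfl, rfl⟩ := h'
      rcases hw with rfl | rfl <;> simp at hw'

theorem ne_of_children {T : FullTree} {n u v : T.Node} (h : n.children = some (u, v)) : u ≠ v := by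
  rintro rfl
  exact Set.disjoint_left.1 (desc_of_children h).2.2.2 u.mem_desc_self u.mem_desc_self

end Node

end FullTree

/-! ### Tree automata -/

/-- A deterministic bottom-up tree automaton over the alphabet `L`. A missing child counts as a
child in state `init`, so that leaves need no transition function of their own. -/
structure TreeAutomaton (L : Type*) where
  S : Type
  finite : Finite S
  init : S
  step : L → S → S → S
  acc : Set S

namespace TreeAutomaton

variable {L L' : Type*}

/-- The state reached at the root of a labeled tree. -/
def run (A : TreeAutomaton L) : (T : FullTree) → (T.Node → L) → A.S
  | .leaf, lab => A.step (lab (.root _)) A.init A.init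
  | .node l r, lab => A.step (lab (.root _))
      (A.run l fun u => lab (.left u)) (A.run r fun u => lab (.right u))

/-- The automaton accepts a labeled tree. -/
def Accepts (A : TreeAutomaton L) {T : FullTree} (lab : T.Node → L) : Prop :=
  A.run T lab ∈ A.acc

/-- Complement. -/
def compl (A : TreeAutomaton L) : TreeAutomaton L := { A with acc := A.accᶜ }

theorem run_compl (A : TreeAutomaton L) (T : FullTree) (lab : T.Node → L) :
    A.compl.run T lab = A.run T lab := by
  induction T with
  | leaf => rfl
  | node l r ihl ihr => simp only [run, ihl, ihr]; rfl

theorem accepts_compl (A : TreeAutomaton L) {T : FullTree} (lab : T.Node → L) :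
    A.compl.Accepts lab ↔ ¬ A.Accepts lab := by
  simp only [Accepts, run_compl]
  rfl

/-- Product automaton, accepting the intersection. -/
def inter (A B : TreeAutomaton L) : TreeAutomaton L where
  S := A.S × B.S
  finite := by have := A.finite; have := B.finite; infer_instance
  init := (A.init, B.init)
  step a p q := (A.step a p.1 q.1, B.step a p.2 q.2)
  acc := A.acc ×ˢ B.acc

theorem run_inter (A B : TreeAutomaton L) (T : FullTree) (lab : T.Node → L) :
    (A.inter B).run T lab = (A.run T lab, B.run T lab) := by
  induction T with
  | leaf => rfl
  | node l r ihl ihr => simp only [run, ihl, ihr]; rfl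

theorem accepts_inter (A B : TreeAutomaton L) {T : FullTree} (lab : T.Node → L) :
    (A.inter B).Accepts lab ↔ A.Accepts lab ∧ B.Accepts lab := by
  simp only [Accepts, run_inter]
  rfl

/-- The automaton checking that some label satisfies `p`. -/
def someNode (p : L → Prop) : TreeAutomaton L where
  S := Prop
  finite := inferInstance
  init := False
  step a s t := p a ∨ s ∨ t
  acc := {s | s}

theorem accepts_someNode (p : L → Prop) {T : FullTree} (lab : T.Node → L) :
    (someNode p).Accepts lab ↔ ∃ n, p (lab n) := by
  suffices h : ((someNode p).run T lab : Prop) ↔ ∃ n, p (lab n) from h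
  induction T with
  | leaf =>
    constructor
    · rintro (h | h | h)
      exacts [⟨_, h⟩, h.elim, h.elim]
    · rintro ⟨n, h⟩
      cases n
      exact .inl h
  | node l r ihl ihr =>
    have : ((someNode p).run (.node l r) lab : Prop) ↔ (p (lab (.root _)) ∨
      ((someNode p).run l fun u => lab (.left u)) ∨
      ((someNode p).run r fun u => lab (.right u))) := Iff.rfl
    rw [this, ihl, ihr]
    constructor
    · rintro (h | ⟨n, h⟩ | ⟨n, h⟩)
      exacts [⟨_, h⟩, ⟨_, h⟩, ⟨_, h⟩]
    · rintro ⟨n, h⟩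
      cases n with
      | root => exact .inl h
      | left n => exact .inr (.inl ⟨n, h⟩)
      | right n => exact .inr (.inr ⟨n, h⟩)

/-- The automaton checking that some internal node satisfies `p` and one of its children satisfies
`q`: the first child if `b = true`, the second if `b = false`. A state records whether the root
satisfies `q`, and whether the pattern has been found. -/
def child (b : Bool) (p q : L → Prop) : TreeAutomaton L where
  S := Prop × Prop
  finite := inferInstance
  init := (False, False)
  step a s t := (q a, s.2 ∨ t.2 ∨ p a ∧ if b then s.1 else t.1)
  acc := {s | s.2}

theorem run_child_fst (b : Bool) (p q : L → Prop) (T : FullTree) (lab : T.Node → L) :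
    ((child b p q).run T lab).1 = q (lab (.root T)) := by
  cases T <;> rfl

theorem accepts_child (b : Bool) (p q : L → Prop) {T : FullTree} (lab : T.Node → L) :
    (child b p q).Accepts lab ↔
      ∃ n u v, n.children = some (u, v) ∧ p (lab n) ∧ q (lab (if b then u else v)) := by
  suffices h : (((child b p q).run T lab).2 : Prop) ↔ ∃ n u v, n.children = some (u, v) ∧
    p (lab n) ∧ q (lab (if b then u else v)) from h
  induction T with
  | leaf =>
    have : (((child b p q).run .leaf lab).2 : Prop) ↔
      False ∨ False ∨ p (lab (.root _)) ∧ if b then False else False := Iff.rfl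
    rw [this]
    simp only [ite_self, and_false, or_self, false_iff]
    rintro ⟨n, u, v, h, -⟩
    cases n
    simp [FullTree.Node.children] at h
  | node l r ihl ihr =>
    have : (((child b p q).run (.node l r) lab).2 : Prop) ↔
      ((child b p q).run l fun u => lab (.left u)).2 ∨
      ((child b p q).run r fun u => lab (.right u)).2 ∨ p (lab (.root _)) ∧
        if b then ((child b p q).run l fun u => lab (.left u)).1
          else ((child b p q).run r fun u => lab (.right u)).1 := Iff.rfl
    rw [this, ihl, ihr, run_child_fst, run_child_fst]
    constructor
    · rintro (⟨n, u, v, h, hp, hq⟩ | ⟨n, u, v, h, hp, hq⟩ | ⟨hp, hq⟩)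
      · exact ⟨.left n, .left u, .left v, by simp [FullTree.Node.children, h], hp,
          by cases b <;> exact hq⟩
      · exact ⟨.right n, .right u, .right v, by simp [FullTree.Node.children, h], hp,
          by cases b <;> exact hq⟩
      · exact ⟨.root _, _, _, rfl, hp, by cases b <;> exact hq⟩
    · rintro ⟨n, u, v, h, hp, hq⟩
      cases n with
      | root =>
        simp only [FullTree.Node.children, Option.some.injEq, Prod.mk.injEq] at h
        obtain ⟨rfl, rfl⟩ := h
        exact .inr (.inr ⟨hp, by cases b <;> exact hq⟩)
      | left n =>
        simp only [FullTree.Node.children, Option.map_eq_some_iff, Prod.mk.injEq] at h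
        obtain ⟨⟨u', v'⟩, h, rfl, rfl⟩ := h
        exact .inl ⟨n, u', v', h, hp, by cases b <;> exact hq⟩
      | right n =>
        simp only [FullTree.Node.children, Option.map_eq_some_iff, Prod.mk.injEq] at h
        obtain ⟨⟨u', v'⟩, h, rfl, rfl⟩ := h
        exact .inr (.inl ⟨n, u', v', h, hp, by cases b <;> exact hq⟩)

/-- Powerset construction: the automaton guesses, for each node, the second argument of `g`. -/
def guessSet (A : TreeAutomaton L') (g : L → Prop → L') : TreeAutomaton L where
  S := Set A.S
  finite := by have := A.finite; infer_instance
  init := {A.init}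
  step a P Q := {s | ∃ b, ∃ p ∈ P, ∃ q ∈ Q, A.step (g a b) p q = s}
  acc := {P | ∃ p ∈ P, p ∈ A.acc}

theorem run_guessSet (A : TreeAutomaton L') (g : L → Prop → L') (T : FullTree) (lab : T.Node → L) :
    (A.guessSet g).run T lab =
      {s | ∃ X : Set T.Node, A.run T (fun n => g (lab n) (n ∈ X)) = s} := by
  induction T with
  | leaf =>
    have : (A.guessSet g).run .leaf lab = {s | ∃ b, ∃ p ∈ ({A.init} : Set A.S),
      ∃ q ∈ ({A.init} : Set A.S), A.step (g (lab (.root _)) b) p q = s} := rfl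
    rw [this]
    refine Set.ext fun s => ?_
    constructor
    · rintro ⟨b, _, rfl, _, rfl, rfl⟩
      exact ⟨{_n | b}, rfl⟩
    · rintro ⟨X, rfl⟩
      exact ⟨_, _, rfl, _, rfl, rfl⟩
  | node l r ihl ihr =>
    have : (A.guessSet g).run (.node l r) lab = (A.guessSet g).step (lab (.root _))
      ((A.guessSet g).run l fun u => lab (.left u))
      ((A.guessSet g).run r fun u => lab (.right u)) := rfl
    rw [this, ihl, ihr]
    refine Set.ext fun s => ?_
    constructor
    · rintro ⟨b, _, ⟨X, rfl⟩, _, ⟨Y, rfl⟩, rfl⟩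
      refine ⟨{n | match n with | .root _ => b | .left u => u ∈ X | .right u => u ∈ Y}, rfl⟩
    · rintro ⟨X, rfl⟩
      exact ⟨_, _, ⟨{u | .left u ∈ X}, rfl⟩, _, ⟨{u | .right u ∈ X}, rfl⟩, rfl⟩

theorem accepts_guessSet (A : TreeAutomaton L') (g : L → Prop → L') {T : FullTree}
    (lab : T.Node → L) :
    (A.guessSet g).Accepts lab ↔ ∃ X : Set T.Node, A.Accepts fun n => g (lab n) (n ∈ X) := by
  simp only [Accepts, run_guessSet]
  constructor
  · rintro ⟨_, ⟨X, rfl⟩, h⟩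
    exact ⟨X, h⟩
  · rintro ⟨X, h⟩
    exact ⟨_, ⟨X, rfl⟩, h⟩

/-- The automaton guesses one node, at which the second argument of `g` is true. A state consists of
the state of `A` before the node has been guessed, and the set of its possible states
afterwards. -/
def guessNode (A : TreeAutomaton L') (g : L → Prop → L') : TreeAutomaton L where
  S := A.S × Set A.S
  finite := by have := A.finite; infer_instance
  init := (A.init, ∅)
  step a P Q := (A.step (g a False) P.1 Q.1,
    {s | A.step (g a True) P.1 Q.1 = s ∨ (∃ p ∈ P.2, A.step (g a False) p Q.1 = s) ∨
      ∃ q ∈ Q.2, A.step (g a False) P.1 q = s})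
  acc := {P | ∃ p ∈ P.2, p ∈ A.acc}

theorem run_guessNode (A : TreeAutomaton L') (g : L → Prop → L') (T : FullTree)
    (lab : T.Node → L) :
    (A.guessNode g).run T lab =
      (A.run T (fun n => g (lab n) False),
        {s | ∃ x : T.Node, A.run T (fun n => g (lab n) (x = n)) = s}) := by
  induction T with
  | leaf =>
    have : (A.guessNode g).run .leaf lab = (A.step (g (lab (.root _)) False) A.init A.init,
      {s | A.step (g (lab (.root _)) True) A.init A.init = s ∨
        (∃ p ∈ (∅ : Set A.S), A.step (g (lab (.root _)) False) p A.init = s) ∨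
        ∃ q ∈ (∅ : Set A.S), A.step (g (lab (.root _)) False) A.init q = s}) := rfl
    rw [this]
    refine Prod.ext rfl ?_
    ext s
    simp only [Set.mem_empty_iff_false, false_and, exists_false, or_false, Set.mem_ofPred_eq, run]
    constructor
    · rintro rfl
      exact ⟨.root _, by simp⟩
    · rintro ⟨x, rfl⟩
      cases x
      simp
  | node l r ihl ihr =>
    have : (A.guessNode g).run (.node l r) lab = (A.guessNode g).step (lab (.root _))
      ((A.guessNode g).run l fun u => lab (.left u))
      ((A.guessNode g).run r fun u => lab (.right u)) := rfl
    rw [this, ihl, ihr]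
    refine Prod.ext rfl ?_
    ext s
    simp only [guessNode, Set.mem_ofPred_eq, run]
    constructor
    · rintro (rfl | ⟨_, ⟨x, rfl⟩, rfl⟩ | ⟨_, ⟨x, rfl⟩, rfl⟩)
      · exact ⟨.root _, by simp⟩
      · exact ⟨.left x, by simp⟩
      · exact ⟨.right x, by simp⟩
    · rintro ⟨x, rfl⟩
      cases x with
      | root => left; simp
      | left x => right; left; exact ⟨_, ⟨x, rfl⟩, by simp⟩
      | right x => right; right; exact ⟨_, ⟨x, rfl⟩, by simp⟩

theorem accepts_guessNode (A : TreeAutomaton L') (g : L → Prop → L') {T : FullTree}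
    (lab : T.Node → L) :
    (A.guessNode g).Accepts lab ↔ ∃ x : T.Node, A.Accepts fun n => g (lab n) (x = n) := by
  simp only [Accepts, run_guessNode]
  constructor
  · rintro ⟨_, ⟨X, rfl⟩, h⟩
    exact ⟨X, h⟩
  · rintro ⟨X, h⟩
    exact ⟨_, ⟨X, rfl⟩, h⟩

end TreeAutomaton

/-! ### From formulas to automata -/

namespace MSO

variable {Γ : Type*}

/-- The letters read by automata for formulas with `f` first-order and `s` second-order free
variables: the label of a node, the first-order variables whose value is the node, and the
second-order variables whose value contains the node. -/
abbrev Letter (Γ : Type*) (f s : ℕ) : Type _ := Set Γ × Set (Fin f) × Set (Fin s)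

/-- The labeling of a tree by letters that encodes a labeling and a valuation. -/
def letters {T : FullTree} {f s : ℕ} (lab : T.Node → Set Γ) (v : Fin f → T.Node)
    (V : Fin s → Set T.Node) (n : T.Node) : Letter Γ f s :=
  (lab n, {x | v x = n}, {X | n ∈ V X})

/-- Add to a letter the information whether the value of a new first-order variable is the
node. -/
def bindNode {f s : ℕ} (a : Letter Γ f s) (b : Prop) : Letter Γ (f + 1) s :=
  (a.1, {x | Fin.cases b (· ∈ a.2.1) x}, a.2.2)

/-- Add to a letter the information whether the value of a new second-order variable contains the
node. -/
def bindSet {f s : ℕ} (a : Letter Γ f s) (b : Prop) : Letter Γ f (s + 1) :=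
  (a.1, a.2.1, {X | Fin.cases b (· ∈ a.2.2) X})

theorem letters_cons_node {f s : ℕ} {T : FullTree} (lab : T.Node → Set Γ) (v : Fin f → T.Node)
    (V : Fin s → Set T.Node) (x : T.Node) : letters lab (Fin.cons x v) V =
      fun n => bindNode (letters lab v V n) (x = n) := by
  funext n
  refine Prod.ext rfl (Prod.ext ?_ rfl)
  ext y
  refine Fin.cases ?_ (fun y => ?_) y <;> simp [letters, bindNode]

theorem letters_cons_set {f s : ℕ} {T : FullTree} (lab : T.Node → Set Γ) (v : Fin f → T.Node)
    (V : Fin s → Set T.Node) (S : Set T.Node) : letters lab v (Fin.cons S V) =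
      fun n => bindSet (letters lab v V n) (n ∈ S) := by
  funext n
  refine Prod.ext rfl (Prod.ext rfl ?_)
  ext y
  refine Fin.cases ?_ (fun y => ?_) y <;> simp [letters, bindSet]

/-- Every MSO formula is equivalent to a tree automaton. -/
theorem exists_automaton {f s : ℕ} (φ : MSO Γ f s) : ∃ A : TreeAutomaton (Letter Γ f s),
    ∀ (T : FullTree) (lab : T.Node → Set Γ) (v : Fin f → T.Node) (V : Fin s → Set T.Node),
      φ.Sat lab v V ↔ A.Accepts (letters lab v V) := by
  induction φ with
  | eq x y =>
    refine ⟨.someNode fun a => x ∈ a.2.1 ∧ y ∈ a.2.1, fun T lab v V => ?_⟩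
    simp [TreeAutomaton.accepts_someNode, Sat, letters, eq_comm]
  | child₁ x y =>
    refine ⟨.child true (fun a => x ∈ a.2.1) (fun a => y ∈ a.2.1), fun T lab v V => ?_⟩
    simp only [TreeAutomaton.accepts_child, Sat, letters, Set.mem_ofPred_eq, if_true]
    constructor
    · rintro ⟨u, h⟩
      exact ⟨_, _, _, h, rfl, rfl⟩
    · rintro ⟨_, _, w, h, rfl, rfl⟩
      exact ⟨w, h⟩
  | child₂ x y =>
    refine ⟨.child false (fun a => x ∈ a.2.1) (fun a => y ∈ a.2.1), fun T lab v V => ?_⟩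
    simp only [TreeAutomaton.accepts_child, Sat, letters, Set.mem_ofPred_eq, Bool.false_eq_true,
      if_false]
    constructor
    · rintro ⟨u, h⟩
      exact ⟨_, _, _, h, rfl, rfl⟩
    · rintro ⟨_, w, _, h, rfl, rfl⟩
      exact ⟨w, h⟩
  | label l x =>
    refine ⟨.someNode fun a => x ∈ a.2.1 ∧ l ∈ a.1, fun T lab v V => ?_⟩
    simp [TreeAutomaton.accepts_someNode, Sat, letters]
  | mem x X =>
    refine ⟨.someNode fun a => x ∈ a.2.1 ∧ X ∈ a.2.2, fun T lab v V => ?_⟩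
    simp [TreeAutomaton.accepts_someNode, Sat, letters]
  | not φ ih =>
    obtain ⟨A, hA⟩ := ih
    exact ⟨A.compl, fun T lab v V => by rw [A.accepts_compl, ← hA]; rfl⟩
  | and φ ψ ihφ ihψ =>
    obtain ⟨A, hA⟩ := ihφ
    obtain ⟨B, hB⟩ := ihψ
    exact ⟨A.inter B, fun T lab v V => by rw [A.accepts_inter, ← hA, ← hB]; rfl⟩
  | or φ ψ ihφ ihψ =>
    obtain ⟨A, hA⟩ := ihφ
    obtain ⟨B, hB⟩ := ihψ
    refine ⟨(A.compl.inter B.compl).compl, fun T lab v V => ?_⟩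
    rw [TreeAutomaton.accepts_compl, TreeAutomaton.accepts_inter, TreeAutomaton.accepts_compl,
      TreeAutomaton.accepts_compl, ← hA, ← hB, ← not_or, not_not]
    rfl
  | @exists₁ f s φ ih =>
    obtain ⟨A, hA⟩ := ih
    exact ⟨A.guessNode bindNode, fun T lab v V => by
      simp only [A.accepts_guessNode, ← letters_cons_node, ← hA]; rfl⟩
  | @forall₁ f s φ ih =>
    obtain ⟨A, hA⟩ := ih
    exact ⟨(A.compl.guessNode bindNode).compl, fun T lab v V => by
      simp only [TreeAutomaton.accepts_compl, TreeAutomaton.accepts_guessNode,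
        ← letters_cons_node, ← hA, not_exists, not_not]; rfl⟩
  | @exists₂ f s φ ih =>
    obtain ⟨A, hA⟩ := ih
    exact ⟨A.guessSet bindSet, fun T lab v V => by
      simp only [A.accepts_guessSet, ← letters_cons_set, ← hA]; rfl⟩
  | @forall₂ f s φ ih =>
    obtain ⟨A, hA⟩ := ih
    exact ⟨(A.compl.guessSet bindSet).compl, fun T lab v V => by
      simp only [TreeAutomaton.accepts_compl, TreeAutomaton.accepts_guessSet,
        ← letters_cons_set, ← hA, not_exists, not_not]; rfl⟩

end MSO

/-! ### Renaming the gates of a circuit -/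

namespace Circuit

variable {G G' τ : Type*}

/-- The circuit with its gates renamed along a bijection. -/
def rename (C : Circuit G τ) (e : G ≃ G') : Circuit G' τ where
  Wire a b := C.Wire (e.symm a) (e.symm b)
  out := e C.out
  type a := C.type (e.symm a)
  finite := by have := C.finite; exact Finite.of_equiv _ e
  acyclic a h := C.acyclic (e.symm a) (Relation.TransGen.lift e.symm (fun _ _ h => h) a a h)

theorem inputs_rename (C : Circuit G τ) (e : G ≃ G') (a : G') :
    (C.rename e).inputs a = e.symm ⁻¹' C.inputs (e.symm a) := rfl

theorem fanIn_rename (C : Circuit G τ) (e : G ≃ G') (a : G') :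
    (C.rename e).fanIn a = C.fanIn (e.symm a) := by
  rw [fanIn, inputs_rename, ← e.image_eq_preimage_symm, Set.ncard_image_of_injective _ e.injective,
    fanIn]

theorem maxFanIn_rename (C : Circuit G τ) (e : G ≃ G') : (C.rename e).maxFanIn = C.maxFanIn := by
  simp only [maxFanIn, fanIn_rename]
  exact e.symm.iSup_comp (g := C.fanIn)

theorem reflTransGen_rename (C : Circuit G τ) (e : G ≃ G') (a b : G') :
    Relation.ReflTransGen (C.rename e).Wire a b ↔
      Relation.ReflTransGen C.Wire (e.symm a) (e.symm b) := by
  constructor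
  · exact fun h => Relation.ReflTransGen.lift e.symm (fun _ _ h => h) a b h
  · intro h
    have := Relation.ReflTransGen.lift (r := C.Wire) (p := (C.rename e).Wire) e
      (fun x y h => by simpa [rename, Function.onFun] using h) _ _ h
    simpa [Function.onFun] using this

theorem dependencySize_rename (C : Circuit G τ) (e : G ≃ G') :
    (C.rename e).dependencySize = C.dependencySize := by
  have h a : ((C.rename e).dependents a).ncard = (C.dependents (e.symm a)).ncard := by
    have : (C.rename e).dependents a = e '' C.dependents (e.symm a) := by
      rw [e.image_eq_preimage_symm]
      exact Set.ext fun b => C.reflTransGen_rename e a b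
    rw [this, Set.ncard_image_of_injective _ e.injective]
  simp only [dependencySize, h]
  exact e.symm.iSup_comp (g := fun g => (C.dependents g).ncard)

end Circuit

namespace SetCircuit

variable {G G' X : Type*}

/-- The set-valued circuit with its gates renamed along a bijection. -/
def rename (C : SetCircuit G X) (e : G ≃ G') : SetCircuit G' X where
  toCircuit := C.toCircuit.rename e
  svar_unique x a b h h' := e.symm.injective (C.svar_unique x _ _ h h')
  svar_fanIn x a h := by rw [Circuit.fanIn_rename]; exact C.svar_fanIn x _ h
  times_fanIn a h := by rw [Circuit.fanIn_rename]; exact C.times_fanIn _ h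

theorem captured_rename (C : SetCircuit G X) (e : G ≃ G') (g : G) :
    (C.rename e).captured (e g) = C.captured g := by
  induction g using C.wf.induction with
  | _ g ih =>
    have ih' : ∀ a, C.Wire (e.symm a) g → (C.rename e).captured a = C.captured (e.symm a) := by
      intro a h
      rw [← ih _ h, e.apply_symm_apply]
    have hw : ∀ a, (C.rename e).Wire a (e g) ↔ C.Wire (e.symm a) g := fun a => by
      simp [rename, Circuit.rename]
    have ht : (C.rename e).type (e g) = C.type g := by simp [rename, Circuit.rename]
    rw [captured_eq, captured_eq, ht]
    split
    · rfl
    · ext x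
      constructor
      · rintro ⟨a, h, hx⟩
        rw [hw] at h
        exact ⟨_, h, ih' a h ▸ hx⟩
      · rintro ⟨a, h, hx⟩
        exact ⟨e a, by rwa [hw, e.symm_apply_apply], by rwa [ih a h]⟩
    · have h1 : (C.rename e).inputs (e g) = ∅ ↔ C.inputs g = ∅ := by
        have : (C.rename e).inputs (e g) = e.symm ⁻¹' C.inputs g := Set.ext fun a => hw a
        rw [this]
        simp only [Set.eq_empty_iff_forall_notMem, Set.mem_preimage]
        exact e.symm.forall_congr_right (q := fun x => x ∉ C.inputs g)
      rw [h1]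
      congr 1
      ext x
      constructor
      · rintro ⟨a, b, ha, hb, hab, s, hs, t, ht, rfl⟩
        rw [hw] at ha hb
        exact ⟨_, _, ha, hb, fun h => hab (e.symm.injective h), s, ih' a ha ▸ hs, t,
          ih' b hb ▸ ht, rfl⟩
      · rintro ⟨a, b, ha, hb, hab, s, hs, t, ht, rfl⟩
        exact ⟨e a, e b, by rwa [hw, e.symm_apply_apply], by rwa [hw, e.symm_apply_apply],
          fun h => hab (e.injective h), s, by rwa [ih a ha], t, by rwa [ih b hb], rfl⟩

theorem captured_rename' (C : SetCircuit G X) (e : G ≃ G') (a : G') :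
    (C.rename e).captured a = C.captured (e.symm a) := by
  rw [← C.captured_rename e, e.apply_symm_apply]

theorem dom_rename (C : SetCircuit G X) (e : G ≃ G') (a : G') :
    (C.rename e).dom a = C.dom (e.symm a) := by
  ext x
  constructor
  · rintro ⟨b, hb, h⟩
    exact ⟨_, hb, (C.reflTransGen_rename e b a).1 h⟩
  · rintro ⟨b, hb, h⟩
    exact ⟨e b, by simpa [rename, Circuit.rename] using hb,
      (C.reflTransGen_rename e _ a).2 (by simpa using h)⟩

theorem isDDNNF_rename {C : SetCircuit G X} (e : G ≃ G') (h : C.IsDDNNF) :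
    (C.rename e).IsDDNNF := by
  refine ⟨fun g hg a b ha hb hab => ?_, fun g hg a b ha hb hab => ?_⟩
  · rw [dom_rename, dom_rename]
    exact h.1 _ hg _ _ ha hb fun h => hab (e.symm.injective h)
  · rw [captured_rename', captured_rename']
    exact h.2 _ hg _ _ ha hb fun h => hab (e.symm.injective h)

theorem isUpwardsDeterministic_rename {C : SetCircuit G X} (e : G ≃ G')
    (h : C.IsUpwardsDeterministic) : (C.rename e).IsUpwardsDeterministic := by
  have hp : ∀ a b, (C.rename e).Pure a b → C.Pure (e.symm a) (e.symm b) := by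
    rintro a b ⟨h, h' | ⟨h', c, hc, hca, hc'⟩⟩
    · exact ⟨h, .inl h'⟩
    · exact ⟨h, .inr ⟨h', _, hc, fun h => hca (e.symm.injective h), by
        rwa [captured_rename'] at hc'⟩⟩
  exact fun a b c hb hc => e.symm.injective (h _ _ _ (hp _ _ hb) (hp _ _ hc))

end SetCircuit

namespace HybridCircuit

variable {G G' X B : Type*}

/-- The hybrid circuit with its gates renamed along a bijection. -/
def rename (C : HybridCircuit G X B) (e : G ≃ G') : HybridCircuit G' X B where
  toCircuit := C.toCircuit.rename e
  svar_unique x a b h h' := e.symm.injective (C.svar_unique x _ _ h h')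
  bvar_unique x a b h h' := e.symm.injective (C.bvar_unique x _ _ h h')
  out_set := by simpa [Circuit.rename] using C.out_set
  svar_fanIn x a h := by rw [Circuit.fanIn_rename]; exact C.svar_fanIn x _ h
  bvar_fanIn x a h := by rw [Circuit.fanIn_rename]; exact C.bvar_fanIn x _ h
  and_inputs a b h h' := C.and_inputs _ _ h h'
  or_inputs a b h h' := C.or_inputs _ _ h h'
  not_inputs a b h h' := C.not_inputs _ _ h h'
  not_fanIn a h := by rw [Circuit.fanIn_rename]; exact C.not_fanIn _ h
  union_inputs a b h h' := C.union_inputs _ _ h h'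
  times_inputs a b h h' := C.times_inputs _ _ h h'
  times_fanIn a h := by rw [Circuit.fanIn_rename]; exact C.times_fanIn _ h
  boxtimes_inputs a h := by
    obtain ⟨x, y, hx, hy, hxy⟩ := C.boxtimes_inputs _ h
    refine ⟨e x, e y, by simpa [Circuit.rename] using hx, by simpa [Circuit.rename] using hy, ?_⟩
    rw [Circuit.inputs_rename, hxy, ← e.image_eq_preimage_symm, Set.image_pair]

theorem bval_rename (C : HybridCircuit G X B) (e : G ≃ G') (ν : B → Bool) (g : G) :
    (C.rename e).bval ν (e g) ↔ C.bval ν g := by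
  induction g using C.wf.induction with
  | _ g ih =>
    have ih' : ∀ a, C.Wire (e.symm a) g → ((C.rename e).bval ν a ↔ C.bval ν (e.symm a)) := by
      intro a h
      rw [← ih _ h, e.apply_symm_apply]
    have hw : ∀ a, (C.rename e).Wire a (e g) ↔ C.Wire (e.symm a) g := fun a => by
      simp [rename, Circuit.rename]
    have hw' : ∀ a, (C.rename e).Wire (e a) (e g) ↔ C.Wire a g := fun a => by
      simp [rename, Circuit.rename]
    have ht : (C.rename e).type (e g) = C.type g := by simp [rename, Circuit.rename]
    rw [bval_eq, bval_eq, ht]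
    split
    · rfl
    · exact ⟨fun h a ha => (ih a ha).1 (h _ ((hw' a).2 ha)), fun h a ha =>
        (ih' a ((hw a).1 ha)).2 (h _ ((hw a).1 ha))⟩
    · exact ⟨fun ⟨a, ha, h⟩ => ⟨_, (hw a).1 ha, (ih' a ((hw a).1 ha)).1 h⟩,
        fun ⟨a, ha, h⟩ => ⟨_, (hw' a).2 ha, (ih a ha).2 h⟩⟩
    · exact ⟨fun ⟨a, ha, h⟩ => ⟨_, (hw a).1 ha, fun h' => h ((ih' a ((hw a).1 ha)).2 h')⟩,
        fun ⟨a, ha, h⟩ => ⟨_, (hw' a).2 ha, fun h' => h ((ih a ha).1 h')⟩⟩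
    · rfl

theorem eval_rename (C : HybridCircuit G X B) (e : G ≃ G') (ν : B → Bool) :
    (C.rename e).eval ν = (C.eval ν).rename e := by
  classical
  have h : (C.rename e).evalType ν = fun a => C.evalType ν (e.symm a) := by
    funext a
    have : (C.rename e).bval ν a ↔ C.bval ν (e.symm a) := by
      rw [← C.bval_rename e, e.apply_symm_apply]
    have ht : (C.rename e).type a = C.type (e.symm a) := rfl
    simp only [evalType, ht]
    cases C.type (e.symm a) <;> first | rfl | exact if_congr this rfl rfl
  simp only [eval, h]
  rfl

theorem captured_rename (C : HybridCircuit G X B) (e : G ≃ G') (ν : B → Bool) :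
    (C.rename e).captured ν = C.captured ν := by
  rw [captured, eval_rename]
  exact SetCircuit.captured_rename _ e C.out

theorem isDDNNF_rename {C : HybridCircuit G X B} (e : G ≃ G') (h : C.IsDDNNF) :
    (C.rename e).IsDDNNF := fun ν => by
  rw [eval_rename]
  exact SetCircuit.isDDNNF_rename e (h ν)

theorem isUpwardsDeterministic_rename {C : HybridCircuit G X B} (e : G ≃ G')
    (h : C.IsUpwardsDeterministic) : (C.rename e).IsUpwardsDeterministic := fun ν => by
  rw [eval_rename]
  exact SetCircuit.isUpwardsDeterministic_rename e (h ν)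

theorem isProvenanceCircuit_rename {Γ : Type*} {m : ℕ} {T : FullTree}
    {C : HybridCircuit G (Fin m × T.Node) (Γ × T.Node)} {Q : MSO Γ 0 m} (e : G ≃ G')
    (h : C.IsProvenanceCircuit Q) : (C.rename e).IsProvenanceCircuit Q := by
  refine ⟨fun x => ?_, fun b => ?_, fun α => ?_⟩
  · obtain ⟨g, hg⟩ := h.1 x
    exact ⟨e g, by simpa [rename, Circuit.rename] using hg⟩
  · obtain ⟨g, hg⟩ := h.2.1 b
    exact ⟨e g, by simpa [rename, Circuit.rename] using hg⟩
  · rw [captured_rename, h.2.2]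

end HybridCircuit

/-! ### States of an automaton at the nodes of a tree -/

namespace TreeAutomaton

variable {L : Type*} (A : TreeAutomaton L)

/-- The state reached at a node. -/
def stateAt : {T : FullTree} → (T.Node → L) → T.Node → A.S
  | T, lab, .root _ => A.run T lab
  | _, lab, .left u => stateAt (fun n => lab (.left n)) u
  | _, lab, .right u => stateAt (fun n => lab (.right n)) u

/-- The states reached at the two children of a node; both are `init` at a leaf. -/
def childStates {T : FullTree} (lab : T.Node → L) (n : T.Node) : A.S × A.S :=
  match n.children with
  | none => (A.init, A.init)
  | some (u, v) => (A.stateAt lab u, A.stateAt lab v)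

theorem childStates_of_none {T : FullTree} {lab : T.Node → L} {n : T.Node}
    (h : n.children = none) : A.childStates lab n = (A.init, A.init) := by
  simp [childStates, h]

theorem childStates_of_some {T : FullTree} {lab : T.Node → L} {n u v : T.Node}
    (h : n.children = some (u, v)) :
    A.childStates lab n = (A.stateAt lab u, A.stateAt lab v) := by
  simp [childStates, h]

theorem stateAt_eq {T : FullTree} (lab : T.Node → L) (n : T.Node) :
    A.stateAt lab n = A.step (lab n) (A.childStates lab n).1 (A.childStates lab n).2 := by
  induction n with
  | root T => cases T <;> rfl
  | left u ih =>
    rw [stateAt, ih]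
    simp only [childStates, FullTree.Node.children]
    cases u.children <;> rfl
  | right u ih =>
    rw [stateAt, ih]
    simp only [childStates, FullTree.Node.children]
    cases u.children <;> rfl

theorem run_congr {T : FullTree} {lab lab' : T.Node → L} (h : ∀ n, lab n = lab' n) :
    A.run T lab = A.run T lab' := by
  rw [funext h]

theorem stateAt_congr {T : FullTree} {lab lab' : T.Node → L} {n : T.Node}
    (h : ∀ n' ∈ n.desc, lab n' = lab' n') : A.stateAt lab n = A.stateAt lab' n := by
  induction n with
  | root T => exact A.run_congr fun n => h n trivial
  | left u ih => exact ih fun n hn => h _ ⟨n, hn, rfl⟩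
  | right u ih => exact ih fun n hn => h _ ⟨n, hn, rfl⟩

theorem childStates_congr {T : FullTree} {lab lab' : T.Node → L} {n : T.Node}
    (h : ∀ n' ∈ n.desc, n' ≠ n → lab n' = lab' n') :
    A.childStates lab n = A.childStates lab' n := by
  cases hc : n.children with
  | none => simp [childStates, hc]
  | some p =>
    obtain ⟨u, v⟩ := p
    obtain ⟨h1, h2, h3, -⟩ := FullTree.Node.desc_of_children hc
    rw [childStates_of_some A hc, childStates_of_some A hc]
    refine Prod.ext (A.stateAt_congr fun n' hn => h _ ?_ ?_)
      (A.stateAt_congr fun n' hn => h _ ?_ ?_)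
    · rw [h1]; exact .inr (.inl hn)
    · rintro rfl; exact h2 hn
    · rw [h1]; exact .inr (.inr hn)
    · rintro rfl; exact h3 hn

end TreeAutomaton

/-! ### The captured sets of a gate -/

namespace SetCircuit

variable {G X : Type*} (C : SetCircuit G X)

theorem captured_of_svar {g : G} {x : X} (h : C.type g = .svar x) : C.captured g = {{x}} := by
  rw [captured_eq, h]

theorem mem_captured_of_union {g : G} (h : C.type g = .union) {a : Set X} :
    a ∈ C.captured g ↔ ∃ g', C.Wire g' g ∧ a ∈ C.captured g' := by
  rw [captured_eq, h]
  rfl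

theorem captured_of_times_nullary {g : G} (h : C.type g = .times) (hg : C.inputs g = ∅) :
    C.captured g = {∅} := by
  rw [captured_eq, h]
  ext a
  constructor
  · rintro (⟨-, h⟩ | ⟨g₁, _, h₁, -⟩)
    · exact h
    · exact absurd (hg ▸ h₁ : g₁ ∈ (∅ : Set G)) (Set.notMem_empty _)
  · exact fun h => .inl ⟨hg, h⟩

theorem mem_captured_of_times_pair {g g₁ g₂ : G} (h : C.type g = .times)
    (hg : C.inputs g = {g₁, g₂}) (hne : g₁ ≠ g₂) {a : Set X} :
    a ∈ C.captured g ↔ ∃ a₁ ∈ C.captured g₁, ∃ a₂ ∈ C.captured g₂, a = a₁ ∪ a₂ := by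
  have hw : ∀ g', C.Wire g' g ↔ g' = g₁ ∨ g' = g₂ := fun g' => Set.ext_iff.1 hg g'
  rw [captured_eq, h]
  constructor
  · rintro (⟨h, -⟩ | ⟨x, y, hx, hy, hxy, s, hs, t, ht, rfl⟩)
    · exact absurd (hg.symm.trans h) (Set.insert_nonempty _ _).ne_empty
    · rcases (hw x).1 hx with rfl | rfl <;> rcases (hw y).1 hy with rfl | rfl
      · exact absurd rfl hxy
      · exact ⟨s, hs, t, ht, rfl⟩
      · exact ⟨t, ht, s, hs, Set.union_comm _ _⟩
      · exact absurd rfl hxy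
  · rintro ⟨s, hs, t, ht, rfl⟩
    exact .inr ⟨g₁, g₂, (hw _).2 (.inl rfl), (hw _).2 (.inr rfl), hne, s, hs, t, ht, rfl⟩

end SetCircuit

/-! ### The provenance circuit of an automaton -/

/-- The gates built for each node `n` of the tree, where `S` is the set of states. -/
inductive LocalGate (Γ : Type*) (m : ℕ) (S : Type*)
  /-- the variable `⟨X_i : n⟩` -/
  | svar (i : Fin m)
  /-- captures the single assignment `{⟨X_i : n⟩ | i ∈ β}` -/
  | chain (β : Finset (Fin m))
  /-- the variable `⟨l : n⟩` -/
  | bvar (l : Γ)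
  /-- the negation of `⟨l : n⟩` -/
  | neg (l : Γ)
  /-- is true if the label of `n` is `a`; there is one copy for each pair of states -/
  | cond (a : Set Γ) (p q : S)
  /-- captures the assignments below `n` for which the states at the children are `p` and `q` -/
  | prod (p q : S)
  /-- captures the same assignments as `prod p q` if the label of `n` is `a`, and nothing
  otherwise -/
  | box (a : Set Γ) (p q : S)
  /-- extends the assignments of `box a p q` to `n` by `β` -/
  | ext (β : Finset (Fin m)) (a : Set Γ) (p q : S)
  /-- captures the assignments for which the state at `n` is `r` -/
  | state (r : S)

namespace LocalGate

variable {Γ S : Type*} {m : ℕ}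

instance [Finite Γ] [Finite S] : Finite (LocalGate Γ m S) := by
  refine Finite.of_surjective (fun x : Fin m ⊕ Finset (Fin m) ⊕ Γ ⊕ Γ ⊕ (Set Γ × S × S) ⊕ (S × S) ⊕
    (Set Γ × S × S) ⊕ (Finset (Fin m) × Set Γ × S × S) ⊕ S => match x with
    | .inl i => LocalGate.svar i
    | .inr (.inl β) => .chain β
    | .inr (.inr (.inl l)) => .bvar l
    | .inr (.inr (.inr (.inl l))) => .neg l
    | .inr (.inr (.inr (.inr (.inl (a, p, q))))) => .cond a p q
    | .inr (.inr (.inr (.inr (.inr (.inl (p, q)))))) => .prod p q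
    | .inr (.inr (.inr (.inr (.inr (.inr (.inl (a, p, q))))))) => .box a p q
    | .inr (.inr (.inr (.inr (.inr (.inr (.inr (.inl (β, a, p, q)))))))) => .ext β a p q
    | .inr (.inr (.inr (.inr (.inr (.inr (.inr (.inr r))))))) => .state r) fun g => ?_
  cases g with
  | svar i => exact ⟨.inl i, rfl⟩
  | chain β => exact ⟨.inr (.inl β), rfl⟩
  | bvar l => exact ⟨.inr (.inr (.inl l)), rfl⟩
  | neg l => exact ⟨.inr (.inr (.inr (.inl l))), rfl⟩
  | cond a p q => exact ⟨.inr (.inr (.inr (.inr (.inl (a, p, q))))), rfl⟩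
  | prod p q => exact ⟨.inr (.inr (.inr (.inr (.inr (.inl (p, q)))))), rfl⟩
  | box a p q => exact ⟨.inr (.inr (.inr (.inr (.inr (.inr (.inl (a, p, q))))))), rfl⟩
  | ext β a p q =>
    exact ⟨.inr (.inr (.inr (.inr (.inr (.inr (.inr (.inl (β, a, p, q)))))))), rfl⟩
  | state r => exact ⟨.inr (.inr (.inr (.inr (.inr (.inr (.inr (.inr r))))))), rfl⟩

/-- A rank that increases along the wires between the gates of a node. -/
def rank : LocalGate Γ m S → ℕ
  | .svar _ => 0
  | .chain β => β.card + 1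
  | .bvar _ => 0
  | .neg _ => 1
  | .cond _ _ _ => 2
  | .prod _ _ => 0
  | .box _ _ _ => 3
  | .ext _ _ _ _ => m + 5
  | .state _ => m + 6

theorem rank_lt (j : LocalGate Γ m S) : j.rank < m + 10 := by
  cases j <;> simp only [rank] <;> try omega
  rename_i β
  have := β.card_le_univ
  simp only [Fintype.card_fin] at this
  omega

/-- The gate type of a gate for the node `n`, which is a leaf if `leaf` holds. At a leaf, the gate
`prod p q` captures `{∅}` if `p` and `q` are both the initial state, and nothing otherwise. -/
noncomputable def type {N : Type*} (init : S) (leaf : Prop) (n : N) :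
    LocalGate Γ m S → HybridGate (Fin m × N) (Γ × N)
  | .svar i => .svar (i, n)
  | .chain _ => .times
  | .bvar l => .bvar (l, n)
  | .neg _ => .not
  | .cond _ _ _ => .and
  | .prod p q => open Classical in if leaf ∧ ¬ (p = init ∧ q = init) then .union else .times
  | .box _ _ _ => .boxtimes
  | .ext _ _ _ _ => .times
  | .state _ => .union

end LocalGate

namespace TreeAutomaton

variable {Γ : Type*} {m : ℕ} (A : TreeAutomaton (MSO.Letter Γ 0 m))

/-- The wires between the gates of a node. -/
inductive LocalWire : LocalGate Γ m A.S → LocalGate Γ m A.S → Prop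
  | svar_chain (i : Fin m) (β : Finset (Fin m)) : i ∈ β → (∀ k ∈ β, i ≤ k) →
      LocalWire (.svar i) (.chain β)
  | chain_chain (i : Fin m) (β β' : Finset (Fin m)) : i ∈ β → (∀ k ∈ β, i ≤ k) → β' = β.erase i →
      LocalWire (.chain β') (.chain β)
  | bvar_neg (l : Γ) : LocalWire (.bvar l) (.neg l)
  | bvar_cond (l : Γ) (a : Set Γ) (p q : A.S) : l ∈ a → LocalWire (.bvar l) (.cond a p q)
  | neg_cond (l : Γ) (a : Set Γ) (p q : A.S) : l ∉ a → LocalWire (.neg l) (.cond a p q)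
  | prod_box (a : Set Γ) (p q : A.S) : LocalWire (.prod p q) (.box a p q)
  | cond_box (a : Set Γ) (p q : A.S) : LocalWire (.cond a p q) (.box a p q)
  | chain_ext (β : Finset (Fin m)) (a : Set Γ) (p q : A.S) : LocalWire (.chain β) (.ext β a p q)
  | box_ext (β : Finset (Fin m)) (a : Set Γ) (p q : A.S) :
      LocalWire (.box a p q) (.ext β a p q)
  | ext_state (β : Finset (Fin m)) (a : Set Γ) (p q r : A.S) : A.step (a, ∅, (β : Set _)) p q = r →
      LocalWire (.ext β a p q) (.state r)

theorem LocalWire.rank_lt {A : TreeAutomaton (MSO.Letter Γ 0 m)} {j j' : LocalGate Γ m A.S}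
    (h : A.LocalWire j j') : j.rank < j'.rank := by
  cases h <;> simp only [LocalGate.rank] <;> try omega
  · rename_i i β hi hm h
    rw [h, Finset.card_erase_of_mem hi]
    have := Finset.card_pos.2 ⟨_, hi⟩
    omega
  · rename_i β a p q
    have := β.card_le_univ
    simp only [Fintype.card_fin] at this
    omega

variable (T : FullTree)

/-- The gates of the provenance circuit: an output gate, and the gates for each node. -/
abbrev Gate : Type _ := Option (T.Node × LocalGate Γ m A.S)

/-- The wires of the provenance circuit. -/
inductive GateWire : A.Gate T → A.Gate T → Prop
  | loc (n : T.Node) (j j' : LocalGate Γ m A.S) : A.LocalWire j j' →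
      GateWire (some (n, j)) (some (n, j'))
  | fst (n u v : T.Node) (p q : A.S) : n.children = some (u, v) →
      GateWire (some (u, .state p)) (some (n, .prod p q))
  | snd (n u v : T.Node) (p q : A.S) : n.children = some (u, v) →
      GateWire (some (v, .state q)) (some (n, .prod p q))
  | out (r : A.S) : r ∈ A.acc → GateWire (some (.root T, .state r)) none

/-- A rank that increases along wires. -/
def gateRank : A.Gate T → ℕ
  | none => (T.height + 1) * (m + 10)
  | some (n, j) => n.height * (m + 10) + j.rank

theorem gateRank_lt {g g' : A.Gate T} (h : A.GateWire T g g') :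
    A.gateRank T g < A.gateRank T g' := by
  -- A step to a larger height outweighs every local rank, as local ranks are below `m + 10`.
  have key : ∀ {a b : ℕ} (r : A.S) (c : ℕ), a < b →
      a * (m + 10) + (LocalGate.state r : LocalGate Γ m A.S).rank < b * (m + 10) + c := by
    intro a b r c h
    have h1 : (a + 1) * (m + 10) ≤ b * (m + 10) := Nat.mul_le_mul_right _ h
    have h2 := (LocalGate.state r : LocalGate Γ m A.S).rank_lt
    rw [Nat.add_mul] at h1
    omega
  cases h with
  | loc n j j' h => exact Nat.add_lt_add_left h.rank_lt _
  | fst n u v p q h => exact key _ _ (FullTree.Node.height_lt_of_children h).1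
  | snd n u v p q h => exact key _ _ (FullTree.Node.height_lt_of_children h).2
  | out r h => exact key (b := T.height + 1) _ 0 (Nat.lt_succ_self _)

/-- The gate types of the provenance circuit. -/
noncomputable def gateType : A.Gate T → HybridGate (Fin m × T.Node) (Γ × T.Node)
  | none => .union
  | some (n, j) => j.type A.init (n.children = none) n

variable {T} in
theorem gateType_prod_of_not {n : T.Node} {p q : A.S}
    (h : ¬ (n.children = none ∧ ¬ (p = A.init ∧ q = A.init))) :
    A.gateType T (some (n, .prod p q)) = .times := if_neg h

variable {T} in
theorem gateType_prod_of {n : T.Node} {p q : A.S}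
    (h : n.children = none ∧ ¬ (p = A.init ∧ q = A.init)) :
    A.gateType T (some (n, .prod p q)) = .union := if_pos h

variable {T} in
theorem type_prod_ne {n : T.Node} {p q : A.S} {t : HybridGate (Fin m × T.Node) (Γ × T.Node)}
    (h1 : t ≠ .union) (h2 : t ≠ .times) : A.gateType T (some (n, .prod p q)) ≠ t := by
  intro h
  simp only [gateType, LocalGate.type] at h
  split at h
  exacts [h1 h.symm, h2 h.symm]

variable {T} in
theorem not_isBoolean_prod (n : T.Node) (p q : A.S) :
    ¬ (A.gateType T (some (n, .prod p q))).IsBoolean := by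
  simp only [gateType, LocalGate.type]
  split <;> exact id

variable [Finite Γ]

/-- The underlying circuit of the provenance circuit. -/
noncomputable def baseCircuit : Circuit (A.Gate T) (HybridGate (Fin m × T.Node) (Γ × T.Node)) where
  Wire := A.GateWire T
  out := none
  type := A.gateType T
  finite := by have := A.finite; infer_instance
  acyclic g h := by
    have key : ∀ {g g'}, Relation.TransGen (A.GateWire T) g g' →
        A.gateRank T g < A.gateRank T g' := by
      intro g g' h
      induction h with
      | single h => exact A.gateRank_lt T h
      | tail _ h ih => exact ih.trans (A.gateRank_lt T h)
    exact (key h).false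

variable {T}

section Inputs

variable (n : T.Node)

theorem inputs_svar (i : Fin m) : (A.baseCircuit T).inputs (some (n, .svar i)) = ∅ :=
  Set.eq_empty_of_forall_notMem fun g h => by
    cases h with
    | loc _ _ _ h => cases h

theorem inputs_bvar (l : Γ) : (A.baseCircuit T).inputs (some (n, .bvar l)) = ∅ :=
  Set.eq_empty_of_forall_notMem fun g h => by
    cases h with
    | loc _ _ _ h => cases h

theorem inputs_chain_empty : (A.baseCircuit T).inputs (some (n, .chain ∅)) = ∅ :=
  Set.eq_empty_of_forall_notMem fun g h => by
    cases h with
    | loc _ _ _ h => cases h <;> simp_all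

theorem inputs_chain {i : Fin m} {β : Finset (Fin m)} (hi : i ∈ β) (hm : ∀ k ∈ β, i ≤ k) :
    (A.baseCircuit T).inputs (some (n, .chain β)) =
      {some (n, .svar i), some (n, .chain (β.erase i))} := by
  ext g
  constructor
  · intro h
    cases h with
    | loc _ _ _ h =>
      cases h with
      | svar_chain k _ hk hk' =>
        rw [le_antisymm (hm k hk) (hk' i hi)]
        exact .inl rfl
      | chain_chain k _ _ hk hk' h =>
        rw [le_antisymm (hm k hk) (hk' i hi), h]
        exact .inr rfl
  · rintro (rfl | rfl)
    · exact .loc _ _ _ (.svar_chain i β hi hm)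
    · exact .loc _ _ _ (.chain_chain i β _ hi hm rfl)

theorem inputs_neg (l : Γ) :
    (A.baseCircuit T).inputs (some (n, .neg l)) = {some (n, .bvar l)} := by
  ext g
  constructor
  · intro h
    cases h with
    | loc _ _ _ h => cases h; rfl
  · rintro rfl
    exact .loc _ _ _ (.bvar_neg l)

theorem inputs_prod_leaf {n : T.Node} (hn : n.children = none) (p q : A.S) :
    (A.baseCircuit T).inputs (some (n, .prod p q)) = ∅ :=
  Set.eq_empty_of_forall_notMem fun g h => by
    cases h with
    | loc _ _ _ h => cases h
    | fst _ _ _ _ _ h => simp [h] at hn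
    | snd _ _ _ _ _ h => simp [h] at hn

theorem inputs_prod {n u v : T.Node} (hn : n.children = some (u, v)) (p q : A.S) :
    (A.baseCircuit T).inputs (some (n, .prod p q)) =
      {some (u, .state p), some (v, .state q)} := by
  ext g
  constructor
  · intro h
    cases h with
    | loc _ _ _ h => cases h
    | fst _ _ _ _ _ h =>
      rw [hn] at h
      cases h
      exact .inl rfl
    | snd _ _ _ _ _ h =>
      rw [hn] at h
      cases h
      exact .inr rfl
  · rintro (rfl | rfl)
    · exact .fst _ _ _ _ _ hn
    · exact .snd _ _ _ _ _ hn

theorem inputs_box (a : Set Γ) (p q : A.S) :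
    (A.baseCircuit T).inputs (some (n, .box a p q)) =
      {some (n, .prod p q), some (n, .cond a p q)} := by
  ext g
  constructor
  · intro h
    cases h with
    | loc _ _ _ h =>
      cases h
      exacts [.inl rfl, .inr rfl]
  · rintro (rfl | rfl)
    · exact .loc _ _ _ (.prod_box a p q)
    · exact .loc _ _ _ (.cond_box a p q)

theorem inputs_ext (β : Finset (Fin m)) (a : Set Γ) (p q : A.S) :
    (A.baseCircuit T).inputs (some (n, .ext β a p q)) =
      {some (n, .chain β), some (n, .box a p q)} := by
  ext g
  constructor
  · intro h
    cases h with
    | loc _ _ _ h =>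
      cases h
      exacts [.inl rfl, .inr rfl]
  · rintro (rfl | rfl)
    · exact .loc _ _ _ (.chain_ext β a p q)
    · exact .loc _ _ _ (.box_ext β a p q)

end Inputs

variable (T)

/-- The provenance circuit of an automaton. -/
noncomputable def circuit : HybridCircuit (A.Gate T) (Fin m × T.Node) (Γ × T.Node) where
  toCircuit := A.baseCircuit T
  svar_unique x g g' h h' := by
    rcases g with _ | ⟨n, j⟩
    · cases h
    rcases g' with _ | ⟨n', j'⟩
    · cases h'
    cases j with
    | svar i =>
      cases h
      cases j' with
      | svar i' => cases h'; rfl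
      | prod p q => exact absurd h' (A.type_prod_ne (by simp) (by simp))
      | _ => cases h'
    | prod p q => exact absurd h (A.type_prod_ne (by simp) (by simp))
    | _ => cases h
  bvar_unique x g g' h h' := by
    rcases g with _ | ⟨n, j⟩
    · cases h
    rcases g' with _ | ⟨n', j'⟩
    · cases h'
    cases j with
    | bvar i =>
      cases h
      cases j' with
      | bvar i' => cases h'; rfl
      | prod p q => exact absurd h' (A.type_prod_ne (by simp) (by simp))
      | _ => cases h'
    | prod p q => exact absurd h (A.type_prod_ne (by simp) (by simp))
    | _ => cases h
  out_set := id
  svar_fanIn x g h := by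
    rcases g with _ | ⟨n, j⟩
    · cases h
    cases j with
    | svar i => rw [Circuit.fanIn, inputs_svar, Set.ncard_empty]
    | prod p q => exact absurd h (A.type_prod_ne (by simp) (by simp))
    | _ => cases h
  bvar_fanIn x g h := by
    rcases g with _ | ⟨n, j⟩
    · cases h
    cases j with
    | bvar i => rw [Circuit.fanIn, inputs_bvar, Set.ncard_empty]
    | prod p q => exact absurd h (A.type_prod_ne (by simp) (by simp))
    | _ => cases h
  and_inputs g g' h h' := by
    cases h' with
    | loc _ _ _ h' => cases h' <;> first | (cases h; done) | exact True.intro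
    | out => cases h
    | _ => exact absurd h (A.type_prod_ne (by simp) (by simp))
  or_inputs g g' h h' := by
    cases h' with
    | loc _ _ _ h' => cases h' <;> cases h
    | out => cases h
    | _ => exact absurd h (A.type_prod_ne (by simp) (by simp))
  not_inputs g g' h h' := by
    cases h' with
    | loc _ _ _ h' => cases h' <;> first | (cases h; done) | exact True.intro
    | out => cases h
    | _ => exact absurd h (A.type_prod_ne (by simp) (by simp))
  not_fanIn g h := by
    rcases g with _ | ⟨n, j⟩
    · cases h
    cases j with
    | neg l => rw [Circuit.fanIn, inputs_neg, Set.ncard_singleton]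
    | prod p q => exact absurd h (A.type_prod_ne (by simp) (by simp))
    | _ => cases h
  union_inputs g g' h h' := by
    cases h' with
    | loc _ _ _ h' => cases h' <;> first | (cases h; done) | exact id
    | _ => exact id
  times_inputs g g' h h' := by
    cases h' with
    | loc _ _ _ h' => cases h' <;> first | (cases h; done) | exact id
    | _ => exact id
  times_fanIn g h := by
    rcases g with _ | ⟨n, j⟩
    · cases h
    cases j with
    | chain β =>
      rcases β.eq_empty_or_nonempty with rfl | hβ
      · left
        rw [Circuit.fanIn, inputs_chain_empty, Set.ncard_empty]
      · right
        rw [Circuit.fanIn, A.inputs_chain n (β.min'_mem hβ) (fun k hk => β.min'_le k hk),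
          Set.ncard_pair (by simp)]
    | prod p q =>
      cases hc : n.children with
      | none => left; rw [Circuit.fanIn, A.inputs_prod_leaf hc, Set.ncard_empty]
      | some c =>
        right
        have := FullTree.Node.ne_of_children hc
        rw [Circuit.fanIn, A.inputs_prod hc, Set.ncard_pair (by simp [this])]
    | ext β a p q => right; rw [Circuit.fanIn, inputs_ext, Set.ncard_pair (by simp)]
    | _ => cases h
  boxtimes_inputs g h := by
    rcases g with _ | ⟨n, j⟩
    · cases h
    cases j with
    | box a p q => exact ⟨some (n, .prod p q), some (n, .cond a p q), A.not_isBoolean_prod n p q,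
        True.intro, A.inputs_box n a p q⟩
    | prod p q => exact absurd h (A.type_prod_ne (by simp) (by simp))
    | _ => cases h

theorem maxFanIn_circuit_le : (A.circuit T).maxFanIn ≤ Nat.card (LocalGate Γ m A.S) + 2 := by
  have := A.finite
  have hloc : ∀ (n : T.Node),
      (Set.range fun j : LocalGate Γ m A.S => (some (n, j) : A.Gate T)).ncard ≤
        Nat.card (LocalGate Γ m A.S) := by
    intro n
    rw [← Set.image_univ, ← Set.ncard_univ]
    exact Set.ncard_image_le
  refine ciSup_le fun g => ?_
  -- Only the `prod` gates have inputs among the gates of other nodes.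
  by_cases hp : ∃ n p q, g = some (n, .prod p q)
  · obtain ⟨n, p, q, rfl⟩ := hp
    cases hc : n.children with
    | none => simp [Circuit.fanIn, circuit, A.inputs_prod_leaf hc]
    | some c =>
      simp only [Circuit.fanIn, circuit, A.inputs_prod hc]
      exact (Set.ncard_insert_le _ _).trans (by rw [Set.ncard_singleton]; omega)
  · have : ∃ n, (A.circuit T).inputs g ⊆
        Set.range fun j : LocalGate Γ m A.S => (some (n, j) : A.Gate T) := by
      rcases g with _ | ⟨n, j⟩
      · refine ⟨.root T, fun g h => ?_⟩
        cases h
        exact ⟨_, rfl⟩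
      · refine ⟨n, fun g h => ?_⟩
        cases h with
        | loc => exact ⟨_, rfl⟩
        | _ => exact absurd ⟨_, _, _, rfl⟩ hp
    obtain ⟨n, hn⟩ := this
    exact (Set.ncard_le_ncard hn).trans ((hloc n).trans (by omega))

theorem dependencySize_circuit_le :
    (A.circuit T).dependencySize ≤ (Nat.card (LocalGate Γ m A.S) + 1) * (T.height + 1) := by
  have := A.finite
  -- The gates depending on a gate for `n` are the output gate and gates for ancestors of `n`.
  have key : ∀ n : T.Node, (insert none (some '' ({n' | n ∈ n'.desc} ×ˢ
      Set.univ)) : Set (A.Gate T)).ncard ≤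
        (Nat.card (LocalGate Γ m A.S) + 1) * (T.height + 1) := by
    intro n
    refine (Set.ncard_insert_le _ _).trans ?_
    refine (Nat.add_le_add_right Set.ncard_image_le 1).trans ?_
    rw [Set.ncard_prod, Set.ncard_univ, Nat.add_mul, Nat.mul_comm]
    exact Nat.add_le_add (Nat.mul_le_mul_left _ n.ncard_ancestors_le) (by omega)
  refine ciSup_le fun g => ?_
  have : ∃ n : T.Node, (A.circuit T).dependents g ⊆
      insert none (some '' ({n' | n ∈ n'.desc} ×ˢ Set.univ)) := by
    have start : ∃ n : T.Node, g ∈ (insert none (some '' ({n' | n ∈ n'.desc} ×ˢ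
        Set.univ)) : Set (A.Gate T)) := by
      rcases g with _ | ⟨n, j⟩
      · exact ⟨.root T, .inl rfl⟩
      · exact ⟨n, .inr ⟨(n, j), ⟨n.mem_desc_self, trivial⟩, rfl⟩⟩
    obtain ⟨n, hn⟩ := start
    refine ⟨n, fun g' h => ?_⟩
    have up : ∀ {u w : T.Node} {j : LocalGate Γ m A.S} (j' : LocalGate Γ m A.S), u ∈ w.desc →
        some (u, j) ∈ (insert none (some '' ({n' | n ∈ n'.desc} ×ˢ
          Set.univ)) : Set (A.Gate T)) →
        some (w, j') ∈ (insert none (some '' ({n' | n ∈ n'.desc} ×ˢ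
          Set.univ)) : Set (A.Gate T)) := by
      rintro u w j j' h (h' | ⟨_, ⟨h', -⟩, h''⟩)
      · cases h'
      · cases h''
        exact .inr ⟨_, ⟨FullTree.Node.desc_trans h' h, trivial⟩, rfl⟩
    induction h with
    | refl => exact hn
    | tail _ h ih =>
      cases h with
      | loc n j j' h => exact up _ n.mem_desc_self ih
      | fst n u v p q h =>
        refine up _ ?_ ih
        rw [(FullTree.Node.desc_of_children h).1]
        exact .inr (.inl u.mem_desc_self)
      | snd n u v p q h =>
        refine up _ ?_ ih
        rw [(FullTree.Node.desc_of_children h).1]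
        exact .inr (.inr v.mem_desc_self)
      | out => exact .inl rfl
  obtain ⟨n, hn⟩ := this
  exact (Set.ncard_le_ncard hn).trans (key n)

end TreeAutomaton

/-! ### The assignments captured by the provenance circuit -/

namespace TreeAutomaton

variable {Γ : Type*} {m : ℕ} (A : TreeAutomaton (MSO.Letter Γ 0 m)) {T : FullTree}

/-- The assignment that puts the node `n` into the sets with index in `β`. -/
def atNode (β : Finset (Fin m)) (n : T.Node) : Set (Fin m × T.Node) := {x | x.1 ∈ β ∧ x.2 = n}

open Classical in
/-- The indices of the sets into which an assignment puts the node `n`. -/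
noncomputable def fiber (X : Set (Fin m × T.Node)) (n : T.Node) : Finset (Fin m) :=
  Finset.univ.filter fun i => (i, n) ∈ X

theorem mem_fiber {X : Set (Fin m × T.Node)} {n : T.Node} {i : Fin m} :
    i ∈ fiber X n ↔ (i, n) ∈ X := by
  simp [fiber]

/-- The set of labels of a node under a valuation of the Boolean variables. -/
def labelAt (ν : Γ × T.Node → Bool) (n : T.Node) : Set Γ := {l | ν (l, n) = true}

/-- The letters at the nodes of the tree, for a valuation of the Boolean variables and an
assignment. -/
noncomputable def lettersOf (ν : Γ × T.Node → Bool) (X : Set (Fin m × T.Node)) (n : T.Node) :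
    MSO.Letter Γ 0 m :=
  (labelAt ν n, ∅, (fiber X n : Set (Fin m)))

theorem fiber_congr {X Y : Set (Fin m × T.Node)} {n : T.Node}
    (h : ∀ i, (i, n) ∈ X ↔ (i, n) ∈ Y) : fiber X n = fiber Y n := by
  ext i
  rw [mem_fiber, mem_fiber, h]

theorem lettersOf_congr {ν : Γ × T.Node → Bool} {X Y : Set (Fin m × T.Node)} {n : T.Node}
    (h : ∀ i, (i, n) ∈ X ↔ (i, n) ∈ Y) : lettersOf ν X n = lettersOf ν Y n := by
  rw [lettersOf, fiber_congr h, lettersOf]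

variable [Finite Γ] (ν : Γ × T.Node → Bool)

/-- The gate `j` of the node `n` captures the assignment `X` under the valuation `ν`. -/
def Captures (n : T.Node) (j : LocalGate Γ m A.S) (X : Set (Fin m × T.Node)) : Prop :=
  X ∈ ((A.circuit T).eval ν).captured (some (n, j))

theorem inputs_eval {g : A.Gate T} (h : ¬ (A.gateType T g).IsBoolean) :
    ((A.circuit T).eval ν).inputs g = (A.baseCircuit T).inputs g := by
  ext g'
  exact ⟨fun h => h.1, fun h' => ⟨h', h⟩⟩

theorem captures_svar {n : T.Node} {i : Fin m} {X : Set (Fin m × T.Node)} :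
    A.Captures ν n (.svar i) X ↔ X = {(i, n)} := by
  rw [Captures, SetCircuit.captured_of_svar (x := (i, n)) _ rfl]
  rfl

theorem captures_chain {n : T.Node} {β : Finset (Fin m)} {X : Set (Fin m × T.Node)} :
    A.Captures ν n (.chain β) X ↔ X = atNode β n := by
  induction h : β.card generalizing β X with
  | zero =>
    rw [Finset.card_eq_zero] at h
    subst h
    rw [Captures, SetCircuit.captured_of_times_nullary]
    · simp [atNode]
    · rfl
    · rw [A.inputs_eval ν (by exact id)]
      exact A.inputs_chain_empty n
  | succ k ih =>
    have hβ : β.Nonempty := Finset.card_pos.1 (by omega)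
    have hi := β.min'_mem hβ
    have he : β = insert (β.min' hβ) (β.erase (β.min' hβ)) := (Finset.insert_erase hi).symm
    rw [Captures, SetCircuit.mem_captured_of_times_pair _ _
      ((A.inputs_eval ν (by exact id)).trans (A.inputs_chain n hi fun k hk => β.min'_le k hk))
      (by simp)]
    · have hset : atNode β n = {(β.min' hβ, n)} ∪ atNode (β.erase (β.min' hβ)) n := by
        ext ⟨i, n'⟩
        simp only [atNode, Set.mem_ofPred_eq, Set.mem_union, Set.mem_singleton_iff, Prod.mk.injEq,
          Finset.mem_erase]
        constructor
        · rintro ⟨h, rfl⟩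
          by_cases h' : i = β.min' hβ
          · exact .inl ⟨h', rfl⟩
          · exact .inr ⟨⟨h', h⟩, rfl⟩
        · rintro (⟨rfl, rfl⟩ | ⟨⟨-, h⟩, rfl⟩)
          exacts [⟨hi, rfl⟩, ⟨h, rfl⟩]
      have ih' := fun X => ih (β := β.erase (β.min' hβ)) (X := X)
        (by rw [Finset.card_erase_of_mem hi]; omega)
      rw [hset]
      constructor
      · rintro ⟨a₁, h₁, a₂, h₂, rfl⟩
        rw [(A.captures_svar ν).1 h₁, (ih' _).1 h₂]
      · rintro rfl
        exact ⟨_, (A.captures_svar ν).2 rfl, _, (ih' _).2 rfl, rfl⟩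
    · rfl

theorem bval_bvar (n : T.Node) (l : Γ) :
    (A.circuit T).bval ν (some (n, .bvar l)) ↔ l ∈ labelAt ν n := by
  rw [HybridCircuit.bval_eq]
  rfl

theorem bval_neg (n : T.Node) (l : Γ) :
    (A.circuit T).bval ν (some (n, .neg l)) ↔ l ∉ labelAt ν n := by
  rw [HybridCircuit.bval_eq, ← A.bval_bvar]
  change (∃ g', A.GateWire T g' (some (n, .neg l)) ∧ _) ↔ _
  constructor
  · rintro ⟨g, hg, h⟩
    have : g ∈ (A.baseCircuit T).inputs (some (n, .neg l)) := hg
    rw [A.inputs_neg] at this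
    rwa [← this]
  · exact fun h => ⟨_, .loc _ _ _ (.bvar_neg l), h⟩

theorem bval_cond (n : T.Node) (a : Set Γ) (p q : A.S) :
    (A.circuit T).bval ν (some (n, .cond a p q)) ↔ a = labelAt ν n := by
  rw [HybridCircuit.bval_eq]
  change (∀ g', A.GateWire T g' (some (n, .cond a p q)) → _) ↔ _
  constructor
  · intro h
    ext l
    by_cases hl : l ∈ a
    · exact ⟨fun _ => (A.bval_bvar ν n l).1 (h _ (.loc _ _ _ (.bvar_cond l a p q hl))),
        fun _ => hl⟩
    · exact ⟨fun h' => absurd h' hl, fun h' =>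
        absurd h' ((A.bval_neg ν n l).1 (h _ (.loc _ _ _ (.neg_cond l a p q hl))))⟩
  · rintro rfl g h
    cases h with
    | loc _ _ _ h =>
      cases h with
      | bvar_cond l _ _ _ h => exact (A.bval_bvar ν n l).2 h
      | neg_cond l _ _ _ h => exact (A.bval_neg ν n l).2 h

theorem captures_cond {n : T.Node} {a : Set Γ} {p q : A.S} {X : Set (Fin m × T.Node)} :
    A.Captures ν n (.cond a p q) X ↔ a = labelAt ν n ∧ X = ∅ := by
  have hin : ((A.circuit T).eval ν).inputs (some (n, .cond a p q)) = ∅ :=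
    Set.eq_empty_of_forall_notMem fun g h => h.2 True.intro
  have ht : ((A.circuit T).eval ν).type (some (n, .cond a p q)) =
      open Classical in if (A.circuit T).bval ν (some (n, .cond a p q)) then
        SetGate.times else SetGate.union := rfl
  rw [Captures]
  by_cases h : a = labelAt ν n
  · rw [if_pos ((A.bval_cond ν n a p q).2 h)] at ht
    rw [SetCircuit.captured_of_times_nullary _ ht hin]
    simp [h]
  · rw [if_neg (fun h' => h ((A.bval_cond ν n a p q).1 h'))] at ht
    rw [SetCircuit.mem_captured_of_union _ ht]
    simp only [h, false_and, iff_false, not_exists, not_and]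
    exact fun g hg => absurd hg (Set.eq_empty_iff_forall_notMem.1 hin g)

theorem captures_box {n : T.Node} {a : Set Γ} {p q : A.S} {X : Set (Fin m × T.Node)} :
    A.Captures ν n (.box a p q) X ↔ a = labelAt ν n ∧ A.Captures ν n (.prod p q) X := by
  rw [Captures, SetCircuit.mem_captured_of_times_pair _ _
    ((A.inputs_eval ν (by exact id)).trans (A.inputs_box n a p q)) (by simp)]
  · constructor
    · rintro ⟨a₁, h₁, a₂, h₂, rfl⟩
      obtain ⟨h, rfl⟩ := (A.captures_cond ν).1 h₂
      exact ⟨h, by rw [Set.union_empty]; exact h₁⟩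
    · rintro ⟨h, hX⟩
      exact ⟨X, hX, ∅, (A.captures_cond ν).2 ⟨h, rfl⟩, (Set.union_empty X).symm⟩
  · rfl

theorem captures_ext {n : T.Node} {β : Finset (Fin m)} {a : Set Γ} {p q : A.S}
    {X : Set (Fin m × T.Node)} : A.Captures ν n (.ext β a p q) X ↔
      a = labelAt ν n ∧ ∃ Y, A.Captures ν n (.prod p q) Y ∧ X = atNode β n ∪ Y := by
  rw [Captures, SetCircuit.mem_captured_of_times_pair _ _
    ((A.inputs_eval ν (by exact id)).trans (A.inputs_ext n β a p q)) (by simp)]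
  · constructor
    · rintro ⟨a₁, h₁, a₂, h₂, rfl⟩
      obtain ⟨h, h₂⟩ := (A.captures_box ν).1 h₂
      exact ⟨h, a₂, h₂, by rw [(A.captures_chain ν).1 h₁]⟩
    · rintro ⟨h, Y, hY, rfl⟩
      exact ⟨_, (A.captures_chain ν).2 rfl, Y, (A.captures_box ν).2 ⟨h, hY⟩, rfl⟩
  · rfl

theorem captures_state {n : T.Node} {r : A.S} {X : Set (Fin m × T.Node)} :
    A.Captures ν n (.state r) X ↔ ∃ (β : Finset (Fin m)) (a : Set Γ) (p q : A.S),
      A.step (a, ∅, (β : Set (Fin m))) p q = r ∧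
      A.Captures ν n (.ext β a p q) X := by
  rw [Captures, SetCircuit.mem_captured_of_union]
  · constructor
    · rintro ⟨g, ⟨hg, -⟩, hX⟩
      cases hg with
      | loc _ _ _ h =>
        cases h with
        | ext_state β a p q r h => exact ⟨β, a, p, q, h, hX⟩
    · rintro ⟨β, a, p, q, h, hX⟩
      exact ⟨_, ⟨.loc _ _ _ (.ext_state β a p q r h), id⟩, hX⟩
  · rfl

theorem captures_prod_leaf {n : T.Node} (hn : n.children = none) {p q : A.S}
    {X : Set (Fin m × T.Node)} :
    A.Captures ν n (.prod p q) X ↔ (p = A.init ∧ q = A.init) ∧ X = ∅ := by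
  have hin : ((A.circuit T).eval ν).inputs (some (n, .prod p q)) = ∅ :=
    (A.inputs_eval ν (A.not_isBoolean_prod n p q)).trans (A.inputs_prod_leaf hn p q)
  rw [Captures]
  by_cases h : p = A.init ∧ q = A.init
  · have ht : (A.circuit T).type (some (n, .prod p q)) = .times :=
      A.gateType_prod_of_not (by simp [h])
    rw [SetCircuit.captured_of_times_nullary _ _ hin]
    · simp [h]
    · simp only [HybridCircuit.eval, HybridCircuit.evalType, ht]
  · have ht : (A.circuit T).type (some (n, .prod p q)) = .union :=
      A.gateType_prod_of ⟨hn, h⟩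
    rw [SetCircuit.mem_captured_of_union]
    · simp only [h, false_and, iff_false, not_exists, not_and]
      exact fun g hg => absurd hg (Set.eq_empty_iff_forall_notMem.1 hin g)
    · simp only [HybridCircuit.eval, HybridCircuit.evalType, ht]

theorem captures_prod {n u v : T.Node} (hn : n.children = some (u, v)) {p q : A.S}
    {X : Set (Fin m × T.Node)} :
    A.Captures ν n (.prod p q) X ↔
      ∃ Y, A.Captures ν u (.state p) Y ∧ ∃ Z, A.Captures ν v (.state q) Z ∧ X = Y ∪ Z := by
  have ht : (A.circuit T).type (some (n, .prod p q)) = .times :=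
    A.gateType_prod_of_not (by simp [hn])
  have := FullTree.Node.ne_of_children hn
  rw [Captures, SetCircuit.mem_captured_of_times_pair _ _
    ((A.inputs_eval ν (A.not_isBoolean_prod n p q)).trans (A.inputs_prod hn p q))
    (by simp [this])]
  · rfl
  · simp only [HybridCircuit.eval, HybridCircuit.evalType, ht]

/-- If `prod p q` captures exactly the assignments strictly below `n` for which the states at the
children are `p` and `q`, then `ext β a p q` captures exactly the assignments at and below `n`
that agree with `β` at `n`, provided `a` is the label of `n`. -/
theorem captures_ext_of_prod {n : T.Node}
    (h : ∀ p q X, A.Captures ν n (.prod p q) X ↔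
      (∀ x ∈ X, x.2 ∈ n.desc ∧ x.2 ≠ n) ∧ (p, q) = A.childStates (lettersOf ν X) n)
    {β : Finset (Fin m)} {a : Set Γ} {p q : A.S} {X : Set (Fin m × T.Node)} :
    A.Captures ν n (.ext β a p q) X ↔ (∀ x ∈ X, x.2 ∈ n.desc) ∧ a = labelAt ν n ∧
      β = fiber X n ∧ (p, q) = A.childStates (lettersOf ν X) n := by
  rw [captures_ext]
  constructor
  · rintro ⟨ha, Y, hY, rfl⟩
    rw [h] at hY
    refine ⟨?_, ha, ?_, ?_⟩
    · rintro x (⟨-, hx⟩ | hx)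
      · rw [hx]; exact n.mem_desc_self
      · exact (hY.1 x hx).1
    · ext i
      rw [mem_fiber]
      exact ⟨fun hi => .inl ⟨hi, rfl⟩, fun hi => hi.elim (fun hi => hi.1)
        fun hi => absurd rfl (hY.1 _ hi).2⟩
    · rw [hY.2]
      refine A.childStates_congr fun n' _ hn => lettersOf_congr fun i => ?_
      exact ⟨.inr, fun hi => hi.elim (fun hi => absurd hi.2 hn) id⟩
  · rintro ⟨hX, ha, hβ, hs⟩
    refine ⟨ha, {x ∈ X | x.2 ≠ n}, ?_, ?_⟩
    -- The part of `X` strictly below `n` leads to the same states at the children as `X`.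
    · rw [h]
      refine ⟨fun x hx => ⟨hX x hx.1, hx.2⟩, ?_⟩
      rw [hs]
      refine A.childStates_congr fun n' _ hn => lettersOf_congr fun i => ?_
      exact ⟨fun hi => ⟨hi, hn⟩, fun hi => hi.1⟩
    · ext ⟨i, n'⟩
      constructor
      · intro hx
        by_cases hn : n' = n
        · exact .inl ⟨by rw [hβ, mem_fiber, ← hn]; exact hx, hn⟩
        · exact .inr ⟨hx, hn⟩
      · rintro (⟨hi, hn⟩ | hx)
        · rw [hβ, mem_fiber] at hi
          rw [show n' = n from hn]
          exact hi
        · exact hx.1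

/-- If `ext β a p q` captures the right assignments, then so does `state r`. -/
theorem captures_state_of_ext {n : T.Node}
    (h : ∀ β a p q X, A.Captures ν n (.ext β a p q) X ↔ (∀ x ∈ X, x.2 ∈ n.desc) ∧
      a = labelAt ν n ∧ β = fiber X n ∧ (p, q) = A.childStates (lettersOf ν X) n)
    {r : A.S} {X : Set (Fin m × T.Node)} : A.Captures ν n (.state r) X ↔
      (∀ x ∈ X, x.2 ∈ n.desc) ∧ r = A.stateAt (lettersOf ν X) n := by
  rw [captures_state, stateAt_eq]
  constructor
  · rintro ⟨β, a, p, q, rfl, hX⟩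
    obtain ⟨hX', rfl, rfl, hs⟩ := (h _ _ _ _ _).1 hX
    rw [← hs]
    exact ⟨hX', rfl⟩
  · rintro ⟨hX, rfl⟩
    exact ⟨fiber X n, labelAt ν n, _, _, rfl, (h _ _ _ _ _).2 ⟨hX, rfl, rfl, rfl⟩⟩

/-- The gate `prod p q` of a node `n` captures the assignments strictly below `n` for which the
states at the children are `p` and `q`. -/
theorem captures_prod_iff (n : T.Node) (p q : A.S) (X : Set (Fin m × T.Node)) :
    A.Captures ν n (.prod p q) X ↔
      (∀ x ∈ X, x.2 ∈ n.desc ∧ x.2 ≠ n) ∧ (p, q) = A.childStates (lettersOf ν X) n := by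
  induction hk : n.height using Nat.strong_induction_on generalizing n p q X with
  | _ k ih =>
    subst hk
    cases hc : n.children with
    | none =>
      rw [A.captures_prod_leaf ν hc, A.childStates_of_none hc,
        FullTree.Node.desc_of_children_none hc, Prod.mk.injEq, and_comm]
      refine and_congr_left fun _ => ⟨?_, fun h => Set.eq_empty_of_forall_notMem fun x hx => ?_⟩
      · rintro rfl x hx
        exact hx.elim
      · exact (h x hx).2 (h x hx).1
    | some c =>
      obtain ⟨u, v⟩ := c
      obtain ⟨hu, hv⟩ := FullTree.Node.height_lt_of_children hc
      obtain ⟨hd, hnu, hnv, hdis⟩ := FullTree.Node.desc_of_children hc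
      have key : ∀ w : T.Node, w.height < n.height → ∀ (r : A.S) Y,
          A.Captures ν w (.state r) Y ↔
            (∀ x ∈ Y, x.2 ∈ w.desc) ∧ r = A.stateAt (lettersOf ν Y) w :=
        fun w hw r Y => A.captures_state_of_ext ν fun β a p q X =>
          A.captures_ext_of_prod ν fun p q X => ih _ hw w p q X rfl
      simp only [A.captures_prod ν hc, key u hu, key v hv, A.childStates_of_some hc,
        Prod.mk.injEq]
      constructor
      · rintro ⟨Y, ⟨hY, rfl⟩, Z, ⟨hZ, rfl⟩, rfl⟩
        refine ⟨?_, ?_, ?_⟩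
        · rw [hd]
          rintro x (hx | hx)
          · exact ⟨.inr (.inl (hY x hx)), fun h => hnu (h ▸ hY x hx)⟩
          · exact ⟨.inr (.inr (hZ x hx)), fun h => hnv (h ▸ hZ x hx)⟩
        · refine A.stateAt_congr fun n' hn' => lettersOf_congr fun i => ?_
          exact ⟨.inl, fun h => h.elim id fun h =>
            absurd (hZ _ h) (Set.disjoint_left.1 hdis hn')⟩
        · refine A.stateAt_congr fun n' hn' => lettersOf_congr fun i => ?_
          exact ⟨.inr, fun h => h.elim (fun h =>
            absurd hn' (Set.disjoint_left.1 hdis (hY _ h))) id⟩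
      -- An assignment strictly below `n` splits into its parts below the two children.
      · rintro ⟨hX, rfl, rfl⟩
        refine ⟨{x ∈ X | x.2 ∈ u.desc}, ⟨fun x hx => hx.2, ?_⟩,
          {x ∈ X | x.2 ∈ v.desc}, ⟨fun x hx => hx.2, ?_⟩, ?_⟩
        · refine A.stateAt_congr fun n' hn' => lettersOf_congr fun i => ?_
          exact ⟨fun h => ⟨h, hn'⟩, fun h => h.1⟩
        · refine A.stateAt_congr fun n' hn' => lettersOf_congr fun i => ?_
          exact ⟨fun h => ⟨h, hn'⟩, fun h => h.1⟩
        · ext x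
          constructor
          · intro hx
            obtain ⟨h1, h2⟩ := hX x hx
            rw [hd] at h1
            rcases h1 with h1 | h1 | h1
            · exact absurd h1 h2
            · exact .inl ⟨hx, h1⟩
            · exact .inr ⟨hx, h1⟩
          · rintro (hx | hx) <;> exact hx.1

theorem captures_ext_iff (n : T.Node) (β : Finset (Fin m)) (a : Set Γ) (p q : A.S)
    (X : Set (Fin m × T.Node)) :
    A.Captures ν n (.ext β a p q) X ↔ (∀ x ∈ X, x.2 ∈ n.desc) ∧ a = labelAt ν n ∧
      β = fiber X n ∧ (p, q) = A.childStates (lettersOf ν X) n :=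
  A.captures_ext_of_prod ν (A.captures_prod_iff ν n)

/-- The gate `state r` of a node `n` captures the assignments at and below `n` for which the state
at `n` is `r`. -/
theorem captures_state_iff (n : T.Node) (r : A.S) (X : Set (Fin m × T.Node)) :
    A.Captures ν n (.state r) X ↔
      (∀ x ∈ X, x.2 ∈ n.desc) ∧ r = A.stateAt (lettersOf ν X) n :=
  A.captures_state_of_ext ν (A.captures_ext_iff ν n)

/-- Under a valuation, the circuit captures the assignments for which the automaton accepts. -/
theorem captured_circuit :
    (A.circuit T).captured ν = {X | A.Accepts (lettersOf ν X)} := by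
  ext X
  rw [HybridCircuit.captured, SetCircuit.mem_captured_of_union]
  · constructor
    · rintro ⟨g, ⟨hg, -⟩, hX⟩
      cases hg with
      | out r hr =>
        rw [((A.captures_state_iff ν _ r X).1 hX).2] at hr
        exact hr
    · intro h
      exact ⟨_, ⟨.out _ h, id⟩, (A.captures_state_iff ν _ _ X).2 ⟨fun _ _ => trivial, rfl⟩⟩
  · rfl

variable (T) in
theorem isProvenanceCircuit_circuit {Q : MSO Γ 0 m}
    (hA : ∀ (T : FullTree) (lab : T.Node → Set Γ) (v : Fin 0 → T.Node) (V : Fin m → Set T.Node),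
      Q.Sat lab v V ↔ A.Accepts (MSO.letters lab v V)) :
    (A.circuit T).IsProvenanceCircuit Q := by
  refine ⟨fun ⟨i, n⟩ => ⟨some (n, .svar i), rfl⟩,
    fun ⟨l, n⟩ => ⟨some (n, .bvar l), rfl⟩, fun α => ?_⟩
  rw [captured_circuit]
  have key : ∀ B : Fin m → Set T.Node, lettersOf (fun b => open Classical in decide (b ∈ α))
      (MSO.assignment B) = MSO.letters (fun n => {l | (l, n) ∈ α}) Fin.elim0 B := by
    intro B
    funext n
    refine Prod.ext ?_ (Prod.ext (Subsingleton.elim _ _) ?_)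
    · ext l
      simp [lettersOf, labelAt, MSO.letters]
    · ext i
      simp [lettersOf, mem_fiber, MSO.letters, MSO.assignment]
  ext X
  constructor
  · intro h
    refine ⟨fun i => {n | (i, n) ∈ X}, ?_, rfl⟩
    rw [hA, ← key]
    exact h
  · rintro ⟨B, hB, rfl⟩
    rw [hA, ← key] at hB
    exact hB

/-! ### Decomposability and determinism -/

/-- A set containing all variables that have a path to a gate of the node `n`. -/
def localDom (n : T.Node) : LocalGate Γ m A.S → Set (Fin m × T.Node)
  | .svar i => {(i, n)}
  | .chain β => atNode β n
  | .bvar _ | .neg _ | .cond _ _ _ => ∅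
  | .prod _ _ | .box _ _ _ => {x | x.2 ∈ n.desc ∧ x.2 ≠ n}
  | .ext _ _ _ _ | .state _ => {x | x.2 ∈ n.desc}

/-- A set containing all variables that have a path to a gate. -/
def gateDom : A.Gate T → Set (Fin m × T.Node)
  | none => Set.univ
  | some (n, j) => A.localDom n j

theorem gateDom_mono {g g' : A.Gate T} (h : ((A.circuit T).eval ν).Wire g g') :
    A.gateDom g ⊆ A.gateDom g' := by
  obtain ⟨h, hb⟩ := h
  cases h with
  | loc n j j' h =>
    cases h with
    | svar_chain i β hi hm =>
      rintro _ rfl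
      exact ⟨hi, rfl⟩
    | chain_chain i β β' hi hm h =>
      rintro x ⟨hx, hx'⟩
      rw [h] at hx
      exact ⟨Finset.mem_of_mem_erase hx, hx'⟩
    | chain_ext β a p q =>
      rintro x ⟨-, hx⟩
      change x.2 ∈ n.desc
      rw [show x.2 = n from hx]
      exact n.mem_desc_self
    | box_ext β a p q => exact fun x hx => hx.1
    | ext_state β a p q r h => exact subset_rfl
    | prod_box a p q => exact subset_rfl
    | cond_box a p q => exact Set.empty_subset _
    | _ => exact absurd True.intro hb
  | fst n u v p q h =>
    obtain ⟨h1, h2, -⟩ := FullTree.Node.desc_of_children h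
    intro x hx
    refine ⟨?_, ?_⟩
    · rw [h1]; exact .inr (.inl hx)
    · rintro h; exact h2 (h ▸ hx)
  | snd n u v p q h =>
    obtain ⟨h1, -, h2, -⟩ := FullTree.Node.desc_of_children h
    intro x hx
    refine ⟨?_, ?_⟩
    · rw [h1]; exact .inr (.inr hx)
    · rintro h; exact h2 (h ▸ hx)
  | out r h => exact Set.subset_univ _

theorem dom_subset (g : A.Gate T) : ((A.circuit T).eval ν).dom g ⊆ A.gateDom g := by
  rintro x ⟨g', hg', h⟩
  induction h with
  | refl =>
    have h := HybridCircuit.evalType_svar _ hg'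
    rcases g' with _ | ⟨n, j⟩
    · cases h
    cases j with
    | svar i => cases h; exact rfl
    | prod p q => exact absurd h (A.type_prod_ne (by simp) (by simp))
    | _ => cases h
  | tail _ h ih => exact A.gateDom_mono ν h ih

/-- If the inputs of a gate are two gates with disjoint domains, then the gate is decomposable. -/
theorem decomposable_of_inputs {g g₁ g₂ : A.Gate T}
    (h : ((A.circuit T).eval ν).inputs g ⊆ {g₁, g₂}) (hd : Disjoint (A.gateDom g₁) (A.gateDom g₂)) :
    ((A.circuit T).eval ν).Decomposable g := by
  intro x y hx hy hxy
  rcases h hx with rfl | rfl <;> rcases h hy with rfl | rfl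
  · exact absurd rfl hxy
  · exact hd.mono (A.dom_subset ν _) (A.dom_subset ν _)
  · exact hd.symm.mono (A.dom_subset ν _) (A.dom_subset ν _)
  · exact absurd rfl hxy

/-- All gates for a node other than the `state` gates are decomposable, whatever their type. -/
theorem decomposable (n : T.Node) (j : LocalGate Γ m A.S) (hj : ∀ r, j ≠ .state r) :
    ((A.circuit T).eval ν).Decomposable (some (n, j)) := by
  have hbool : (A.gateType T (some (n, j))).IsBoolean →
      ((A.circuit T).eval ν).Decomposable (some (n, j)) :=
    fun h x y hx => absurd h hx.2
  cases j with
  | svar i =>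
    intro x y hx
    exact absurd (show x ∈ (∅ : Set _) from A.inputs_svar n i ▸ hx.1) (Set.notMem_empty _)
  | chain β =>
    rcases β.eq_empty_or_nonempty with rfl | hβ
    · intro x y hx
      exact absurd (show x ∈ (∅ : Set _) from A.inputs_chain_empty n ▸ hx.1) (Set.notMem_empty _)
    · refine A.decomposable_of_inputs ν ((A.inputs_eval ν (by exact id)).trans
        (A.inputs_chain n (β.min'_mem hβ) fun k hk => β.min'_le k hk)).subset ?_
      rw [Set.disjoint_left]
      rintro _ rfl ⟨h, -⟩
      exact Finset.notMem_erase _ _ h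
  | bvar l => exact hbool True.intro
  | neg l => exact hbool True.intro
  | cond a p q => exact hbool True.intro
  | prod p q =>
    cases hc : n.children with
    | none =>
      intro x y hx
      exact absurd (show x ∈ (∅ : Set _) from A.inputs_prod_leaf hc p q ▸ hx.1)
        (Set.notMem_empty _)
    | some c =>
      refine A.decomposable_of_inputs ν ((A.inputs_eval ν (A.not_isBoolean_prod n p q)).trans
        (A.inputs_prod hc p q)).subset ?_
      rw [Set.disjoint_left]
      exact fun x h1 h2 => Set.disjoint_left.1 (FullTree.Node.desc_of_children hc).2.2.2 h1 h2
  | box a p q =>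
    refine A.decomposable_of_inputs ν ((A.inputs_eval ν (by exact id)).trans
      (A.inputs_box n a p q)).subset ?_
    exact Set.disjoint_empty _
  | ext β a p q =>
    refine A.decomposable_of_inputs ν ((A.inputs_eval ν (by exact id)).trans
      (A.inputs_ext n β a p q)).subset ?_
    rw [Set.disjoint_left]
    exact fun x h1 h2 => h2.2 h1.2
  | state r => exact absurd rfl (hj r)

theorem isDDNNF_circuit : (A.circuit T).IsDDNNF := by
  intro ν
  refine ⟨fun g hg => ?_, fun g hg => ?_⟩
  · rcases g with _ | ⟨n, j⟩
    · cases hg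
    · exact A.decomposable ν n j fun r h => by subst h; cases hg
  · intro g₁ g₂ h₁ h₂ hne
    obtain ⟨h₁, hb⟩ := h₁
    obtain ⟨h₂, -⟩ := h₂
    rw [Set.disjoint_left]
    intro X hX₁ hX₂
    refine hne ?_
    cases h₁ with
    | loc n j j' h =>
      cases h with
      | ext_state β a p q r h =>
        cases h₂ with
        | loc _ _ _ h' =>
          cases h' with
          | ext_state β' a' p' q' _ h' =>
            obtain ⟨-, rfl, rfl, h₁⟩ := (A.captures_ext_iff ν n _ _ _ _ X).1 hX₁
            obtain ⟨-, rfl, rfl, h₂⟩ := (A.captures_ext_iff ν n _ _ _ _ X).1 hX₂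
            cases h₁.trans h₂.symm
            rfl
      | bvar_neg => exact absurd True.intro hb
      | bvar_cond => exact absurd True.intro hb
      | neg_cond => exact absurd True.intro hb
      | _ => cases hg
    | fst n u v p q h =>
      have ht : (A.circuit T).type (some (n, .prod p q)) = .times :=
        A.gateType_prod_of_not (by simp [h])
      simp [HybridCircuit.eval, HybridCircuit.evalType, ht] at hg
    | snd n u v p q h =>
      have ht : (A.circuit T).type (some (n, .prod p q)) = .times :=
        A.gateType_prod_of_not (by simp [h])
      simp [HybridCircuit.eval, HybridCircuit.evalType, ht] at hg
    | out r h =>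
      cases h₂ with
      | out r' h' =>
        have h₁ := ((A.captures_state_iff ν _ _ X).1 hX₁).2
        have h₂ := ((A.captures_state_iff ν _ _ X).1 hX₂).2
        rw [h₁, h₂]

end TreeAutomaton

/-! ### Upwards-determinism -/

namespace TreeAutomaton

variable {Γ : Type*} {m : ℕ} (A : TreeAutomaton (MSO.Letter Γ 0 m)) {T : FullTree}
  (ν : Γ × T.Node → Bool)

/-- The possible targets of a pure wire that leaves a given gate. They are determined by the fact
that, under a given valuation, the empty assignment is captured by a single `state` gate of each
node, and so by a single `prod`, `box` and `ext` gate. -/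
def PureTarget : A.Gate T → A.Gate T → Prop
  | some (n, .svar i), g => g = some (n, .chain {i})
  | some (n, .chain β), g => g = some (n, .ext β (labelAt ν n)
      (A.childStates (lettersOf ν ∅) n).1 (A.childStates (lettersOf ν ∅) n).2)
  | some (n, .cond a p q), g => g = some (n, .box a p q)
  | some (n, .prod p q), g => g = some (n, .box (labelAt ν n) p q)
  | some (n, .box a p q), g => g = some (n, .ext ∅ a p q)
  | some (n, .ext β a p q), g =>
    g = some (n, .state (A.step (a, ∅, (β : Set (Fin m))) p q))
  | some (n, .state r), g => n = .root T ∧ g = none ∨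
      ∃ n' u v, n'.children = some (u, v) ∧
        (n = u ∧ g = some (n', .prod r (A.stateAt (lettersOf ν ∅) v)) ∨
          n = v ∧ g = some (n', .prod (A.stateAt (lettersOf ν ∅) u) r))
  | _, _ => False

theorem PureTarget.unique {A : TreeAutomaton (MSO.Letter Γ 0 m)} {ν : Γ × T.Node → Bool}
    {g g₁ g₂ : A.Gate T} (h₁ : A.PureTarget ν g g₁) (h₂ : A.PureTarget ν g g₂) : g₁ = g₂ := by
  rcases g with _ | ⟨n, j⟩
  · exact h₁.elim
  cases j with
  | bvar l => exact h₁.elim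
  | neg l => exact h₁.elim
  | state r =>
    rcases h₁ with ⟨rfl, rfl⟩ | ⟨n₁, u₁, v₁, hc₁, h₁⟩ <;>
      rcases h₂ with ⟨h₂, rfl⟩ | ⟨n₂, u₂, v₂, hc₂, h₂⟩
    · rfl
    · have := FullTree.Node.root_ne_child hc₂
      rcases h₂ with ⟨h, -⟩ | ⟨h, -⟩
      exacts [absurd h.symm this.1, absurd h.symm this.2]
    · have := FullTree.Node.root_ne_child hc₁
      rcases h₁ with ⟨h, -⟩ | ⟨h, -⟩
      exacts [absurd (h.symm.trans h₂) this.1, absurd (h.symm.trans h₂) this.2]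
    · obtain rfl := FullTree.Node.parent_unique hc₁ hc₂
        (h₁.elim (fun h => .inl h.1) fun h => .inr h.1)
        (h₂.elim (fun h => .inl h.1) fun h => .inr h.1)
      rw [hc₁] at hc₂
      cases hc₂
      have := FullTree.Node.ne_of_children hc₁
      rcases h₁ with ⟨h, rfl⟩ | ⟨h, rfl⟩ <;> rcases h₂ with ⟨h', rfl⟩ | ⟨h', rfl⟩
      · rfl
      · exact absurd (h.symm.trans h') this
      · exact absurd (h'.symm.trans h) this
      · rfl
  | _ => exact Eq.trans h₁ (Eq.symm h₂)

variable [Finite Γ]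

/-- If a product gate has the inputs `x` and `y`, then the wire from one of them is pure only if the
other one captures the empty assignment. -/
theorem pure_pair {g g' x y : A.Gate T} (ht : ((A.circuit T).eval ν).type g' ≠ .union)
    (hin : ((A.circuit T).eval ν).inputs g' = {x, y}) (h : ((A.circuit T).eval ν).Pure g g') :
    g = x ∧ ∅ ∈ ((A.circuit T).eval ν).captured y ∨
      g = y ∧ ∅ ∈ ((A.circuit T).eval ν).captured x := by
  obtain ⟨h, h' | ⟨-, g'', hw, hne, hc⟩⟩ := h
  · exact absurd h' ht
  · have h1 : g ∈ ({x, y} : Set _) := hin ▸ h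
    have h2 : g'' ∈ ({x, y} : Set _) := hin ▸ hw
    rcases h1 with rfl | rfl <;> rcases h2 with rfl | rfl
    · exact absurd rfl hne
    · exact .inl ⟨rfl, hc⟩
    · exact .inr ⟨rfl, hc⟩
    · exact absurd rfl hne

theorem atNode_eq_empty {β : Finset (Fin m)} {n : T.Node} (h : ∅ = atNode β n) : β = ∅ := by
  refine Finset.eq_empty_of_forall_notMem fun i hi => ?_
  have : (i, n) ∈ (∅ : Set (Fin m × T.Node)) := by
    rw [h]
    exact ⟨hi, rfl⟩
  exact this

theorem pureTarget_of_pure {g g' : A.Gate T} (h : ((A.circuit T).eval ν).Pure g g') :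
    A.PureTarget ν g g' := by
  have hw := h.1.1
  have hb := h.1.2
  cases hw with
  | loc n j j' hw =>
    cases hw with
    | svar_chain i β hi hm =>
      have hin := (A.inputs_eval ν (by exact id)).trans (A.inputs_chain n hi hm)
      rcases A.pure_pair ν (fun h => by cases h) hin h with ⟨-, hc⟩ | ⟨h, -⟩
      · have := atNode_eq_empty ((A.captures_chain ν).1 hc)
        have : β = {i} := by rw [← Finset.insert_erase hi, this]; rfl
        rw [this]
        exact rfl
      · cases h
    | chain_chain i β β' hi hm _ =>
      have hin := (A.inputs_eval ν (by exact id)).trans (A.inputs_chain n hi hm)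
      rcases A.pure_pair ν (fun h => by cases h) hin h with ⟨h, -⟩ | ⟨-, hc⟩
      · cases h
      · exact absurd ((A.captures_svar ν).1 hc).symm (Set.singleton_ne_empty _)
    | prod_box a p q =>
      have hin := (A.inputs_eval ν (by exact id)).trans (A.inputs_box n a p q)
      rcases A.pure_pair ν (fun h => by cases h) hin h with ⟨-, hc⟩ | ⟨h, -⟩
      · rw [((A.captures_cond ν).1 hc).1]
        exact rfl
      · cases h
    | cond_box a p q => exact rfl
    | chain_ext β a p q =>
      have hin := (A.inputs_eval ν (by exact id)).trans (A.inputs_ext n β a p q)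
      rcases A.pure_pair ν (fun h => by cases h) hin h with ⟨-, hc⟩ | ⟨h, -⟩
      · obtain ⟨ha, hc⟩ := (A.captures_box ν).1 hc
        have := ((A.captures_prod_iff ν _ _ _ _).1 hc).2
        simp only [PureTarget, ← this, ha]
      · cases h
    | box_ext β a p q =>
      have hin := (A.inputs_eval ν (by exact id)).trans (A.inputs_ext n β a p q)
      rcases A.pure_pair ν (fun h => by cases h) hin h with ⟨h, -⟩ | ⟨-, hc⟩
      · cases h
      · rw [atNode_eq_empty ((A.captures_chain ν).1 hc)]
        exact rfl
    | ext_state β a p q r hr =>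
      rw [← hr]
      exact rfl
    | _ => exact absurd True.intro hb
  | fst n u v p q hc =>
    have hin := (A.inputs_eval ν (A.not_isBoolean_prod n p q)).trans (A.inputs_prod hc p q)
    have ht : (A.circuit T).type (some (n, .prod p q)) = .times :=
      A.gateType_prod_of_not (by simp [hc])
    rcases A.pure_pair ν (by simp [HybridCircuit.eval, HybridCircuit.evalType, ht]) hin h with
      ⟨-, h⟩ | ⟨h, -⟩
    · refine .inr ⟨n, u, v, hc, .inl ⟨rfl, ?_⟩⟩
      rw [((A.captures_state_iff ν _ _ _).1 h).2]
    · cases h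
      exact absurd rfl (FullTree.Node.ne_of_children hc)
  | snd n u v p q hc =>
    have hin := (A.inputs_eval ν (A.not_isBoolean_prod n p q)).trans (A.inputs_prod hc p q)
    have ht : (A.circuit T).type (some (n, .prod p q)) = .times :=
      A.gateType_prod_of_not (by simp [hc])
    rcases A.pure_pair ν (by simp [HybridCircuit.eval, HybridCircuit.evalType, ht]) hin h with
      ⟨h, -⟩ | ⟨-, h⟩
    · cases h
      exact absurd rfl (FullTree.Node.ne_of_children hc)
    · refine .inr ⟨n, u, v, hc, .inr ⟨rfl, ?_⟩⟩
      rw [((A.captures_state_iff ν _ _ _).1 h).2]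
  | out r hr => exact .inl ⟨rfl, rfl⟩

theorem isUpwardsDeterministic_circuit : (A.circuit T).IsUpwardsDeterministic :=
  fun ν _ _ _ h₁ h₂ =>
  (A.pureTarget_of_pure ν h₁).unique (A.pureTarget_of_pure ν h₂)

end TreeAutomaton

/-! ### A linear-time program that instantiates templates -/

namespace RAM

/-- The instructions other than jumps. -/
def Instr.IsStraight : Instr → Prop
  | .jump _ | .jzero _ _ => False
  | _ => True

/-- The configuration with its program counter replaced. -/
def Config.goto (s : Config) (p : ℕ) : Config := { s with pc := p }

/-- Execution of a list of instructions in turn. -/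
def execAll (B : List Instr) (s : Config) : Config := B.foldl (fun s i => i.exec s) s

theorem execAll_nil (s : Config) : execAll [] s = s := rfl

theorem execAll_cons (i : Instr) (B : List Instr) (s : Config) :
    execAll (i :: B) s = execAll B (i.exec s) := rfl

theorem execAll_append (B B' : List Instr) (s : Config) :
    execAll (B ++ B') s = execAll B' (execAll B s) := List.foldl_append

theorem Instr.IsStraight.exec_goto {i : Instr} (h : i.IsStraight) (s : Config) (p : ℕ) :
    i.exec (s.goto p) = (i.exec s).goto (p + 1) := by
  cases i <;> first | rfl | exact h.elim

theorem step_at {P P₁ P₂ : Program} {i : Instr} (hP : P = P₁ ++ i :: P₂) {p : ℕ}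
    (hp : p = P₁.length) (s : Config) : step P (s.goto p) = i.exec (s.goto p) := by
  have : P[(s.goto p).pc]? = some i := by
    simp [Config.goto, hP, hp]
  simp [step, this]

theorem iterate_step_block {P P₁ B P₂ : Program} (hP : P = P₁ ++ (B ++ P₂)) {p : ℕ}
    (hp : p = P₁.length) (hB : ∀ i ∈ B, i.IsStraight) (s : Config) :
    (step P)^[B.length] (s.goto p) = (execAll B s).goto (p + B.length) := by
  induction B generalizing P₁ p s with
  | nil => rfl
  | cons i B ih =>
    rw [List.length_cons, Function.iterate_succ_apply, step_at (P₂ := B ++ P₂) (i := i) hP hp,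
      (hB i (by simp)).exec_goto, ih (P₁ := P₁ ++ [i]) (by simp [hP]) (by simp [hp])
        (fun j hj => hB j (by simp [hj]))]
    rw [execAll_cons]
    congr 1
    omega

/-- The configuration `s'` is reached from `s` after at most `k` steps. -/
def Reaches (P : Program) (s s' : Config) (k : ℕ) : Prop := ∃ j ≤ k, (step P)^[j] s = s'

theorem Reaches.trans {P : Program} {s s' s'' : Config} {k k' : ℕ} (h : Reaches P s s' k)
    (h' : Reaches P s' s'' k') : Reaches P s s'' (k + k') := by
  obtain ⟨j, hj, rfl⟩ := h
  obtain ⟨j', hj', rfl⟩ := h'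
  exact ⟨j' + j, by omega, by rw [Function.iterate_add_apply]⟩

theorem Reaches.mono {P : Program} {s s' : Config} {k k' : ℕ} (h : Reaches P s s' k)
    (hk : k ≤ k') : Reaches P s s' k' := by
  obtain ⟨j, hj, rfl⟩ := h
  exact ⟨j, by omega, rfl⟩

theorem reaches_block {P P₁ B P₂ : Program} (hP : P = P₁ ++ (B ++ P₂)) {p : ℕ}
    (hp : p = P₁.length) (hB : ∀ i ∈ B, i.IsStraight) (s : Config) :
    Reaches P (s.goto p) ((execAll B s).goto (p + B.length)) B.length :=
  ⟨_, le_rfl, iterate_step_block hP hp hB s⟩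

theorem reaches_step {P P₁ P₂ : Program} {i : Instr} (hP : P = P₁ ++ i :: P₂) {p : ℕ}
    (hp : p = P₁.length) {s s' : Config} (h : i.exec (s.goto p) = s') :
    Reaches P (s.goto p) s' 1 :=
  ⟨1, le_rfl, by rw [← h]; exact step_at hP hp s⟩

/-- The program that executes `pre`, and then, as long as cell `0` is not zero, executes first
`head`, then `body` or `body₀`, according to whether cell `1` is nonzero or zero, and then
`post`. -/
def loopProgram (pre head body body₀ post : Program) : Program :=
  pre ++ (.jzero 0 (pre.length + head.length + body.length + body₀.length + post.length + 4) ::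
    (head ++ (.jzero 1 (pre.length + head.length + body.length + 3) ::
      (body ++ (.jump (pre.length + head.length + body.length + body₀.length + 3) ::
        (body₀ ++ (post ++ [.jump pre.length])))))))

section Loop

variable {pre head body body₀ post : Program}

local notation "prog" => loopProgram pre head body body₀ post

theorem length_loopProgram : (prog).length =
    pre.length + head.length + body.length + body₀.length + post.length + 4 := by
  simp only [loopProgram, List.length_append, List.length_cons, List.length_nil]
  omega

theorem reaches_loop_pre (hpre : ∀ i ∈ pre, i.IsStraight) (s : Config) :
    Reaches (prog) (s.goto 0) ((execAll pre s).goto pre.length) pre.length := by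
  have h := reaches_block (P := prog) (P₁ := []) (p := 0) rfl rfl hpre s
  rwa [Nat.zero_add] at h

theorem reaches_loop_exit {s : Config} (hs : s.mem 0 = 0) :
    Reaches (prog) (s.goto pre.length) (s.goto (prog).length) 1 := by
  refine reaches_step (P₁ := pre) rfl rfl ?_
  rw [length_loopProgram]
  simp [Instr.exec, Config.goto, hs]

local notation "exitJump" =>
  Instr.jzero 0 (pre.length + head.length + body.length + body₀.length + post.length + 4)
local notation "branchJump" => Instr.jzero 1 (pre.length + head.length + body.length + 3)
local notation "joinJump" =>
  Instr.jump (pre.length + head.length + body.length + body₀.length + 3)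

theorem reaches_loop_head (hhead : ∀ i ∈ head, i.IsStraight) {s : Config} (hs : s.mem 0 ≠ 0) :
    Reaches (prog) (s.goto pre.length)
      ((execAll head s).goto (pre.length + 1 + head.length)) (1 + head.length) := by
  refine (reaches_step (P₁ := pre) rfl rfl (s' := s.goto (pre.length + 1)) ?_).trans ?_
  · simp [Instr.exec, Config.goto, hs]
  · refine reaches_block (P₁ := pre ++ [exitJump]) (B := head) (P₂ := branchJump ::
      (body ++ (joinJump :: (body₀ ++ (post ++ [.jump pre.length]))))) ?_ (by simp) hhead s
    simp only [List.append_assoc, List.singleton_append]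

theorem reaches_loop_branch (s : Config) :
    Reaches (prog) (s.goto (pre.length + 1 + head.length))
      (s.goto (if s.mem 1 = 0 then pre.length + head.length + body.length + 3
        else pre.length + head.length + 2)) 1 := by
  refine reaches_step (P₁ := pre ++ (exitJump :: head)) (i := branchJump)
    (P₂ := body ++ (joinJump :: (body₀ ++ (post ++ [.jump pre.length])))) ?_ ?_ ?_
  · simp only [loopProgram, List.append_assoc, List.cons_append]
  · simp only [List.length_append, List.length_cons]
    omega
  · have h : pre.length + 1 + head.length + 1 = pre.length + head.length + 2 := by omega
    rw [← h]
    rfl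

theorem reaches_loop_post (hpost : ∀ i ∈ post, i.IsStraight) (s : Config) :
    Reaches (prog) (s.goto (pre.length + head.length + body.length + body₀.length + 3))
      ((execAll post s).goto pre.length) (post.length + 1) := by
  refine (reaches_block
    (P₁ := pre ++ (exitJump :: (head ++ (branchJump :: (body ++ (joinJump :: body₀))))))
    (B := post) (P₂ := [.jump pre.length]) ?_ ?_ hpost s).trans ?_
  · simp only [loopProgram, List.append_assoc, List.cons_append]
  · simp only [List.length_append, List.length_cons]
    omega
  · refine reaches_step (P₂ := []) (i := .jump pre.length) (P₁ := pre ++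
      (exitJump :: (head ++ (branchJump :: (body ++ (joinJump :: (body₀ ++ post))))))) ?_ ?_ rfl
    · simp only [loopProgram, List.append_assoc, List.cons_append]
    · simp only [List.length_append, List.length_cons]
      omega

theorem reaches_loop_body (hhead : ∀ i ∈ head, i.IsStraight) (hbody : ∀ i ∈ body, i.IsStraight)
    (hpost : ∀ i ∈ post, i.IsStraight) {s : Config} (hs : s.mem 0 ≠ 0)
    (h1 : (execAll head s).mem 1 ≠ 0) :
    Reaches (prog) (s.goto pre.length)
      ((execAll post (execAll body (execAll head s))).goto pre.length) (prog).length := by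
  have h := (reaches_loop_head (pre := pre) (body := body) (body₀ := body₀) (post := post)
    hhead hs).trans (reaches_loop_branch _)
  rw [if_neg h1] at h
  have h' := reaches_block (P := prog) (P₁ := pre ++ (exitJump :: (head ++ [branchJump])))
    (B := body) (P₂ := joinJump :: (body₀ ++ (post ++ [.jump pre.length])))
    (p := pre.length + head.length + 2)
    (by simp only [loopProgram, List.append_assoc, List.cons_append, List.nil_append])
    (by simp only [List.length_append, List.length_cons, List.length_nil]; omega) hbody
    (execAll head s)
  have h'' := reaches_step (P := prog) (P₁ := pre ++ (exitJump :: (head ++ (branchJump :: body))))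
    (i := joinJump) (P₂ := body₀ ++ (post ++ [.jump pre.length]))
    (p := pre.length + head.length + 2 + body.length)
    (s := execAll body (execAll head s)) (s' := (execAll body (execAll head s)).goto
      (pre.length + head.length + body.length + body₀.length + 3))
    (by simp only [loopProgram, List.append_assoc, List.cons_append])
    (by simp only [List.length_append, List.length_cons]; omega) rfl
  refine (((h.trans h').trans h'').trans (reaches_loop_post hpost _)).mono ?_
  rw [length_loopProgram]
  omega

theorem reaches_loop_body₀ (hhead : ∀ i ∈ head, i.IsStraight)
    (hbody₀ : ∀ i ∈ body₀, i.IsStraight)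
    (hpost : ∀ i ∈ post, i.IsStraight) {s : Config} (hs : s.mem 0 ≠ 0)
    (h1 : (execAll head s).mem 1 = 0) :
    Reaches (prog) (s.goto pre.length)
      ((execAll post (execAll body₀ (execAll head s))).goto pre.length) (prog).length := by
  have h := (reaches_loop_head (pre := pre) (body := body) (body₀ := body₀) (post := post)
    hhead hs).trans (reaches_loop_branch _)
  rw [if_pos h1] at h
  have h' := reaches_block (P := prog)
    (P₁ := pre ++ (exitJump :: (head ++ (branchJump :: (body ++ [joinJump])))))
    (B := body₀) (P₂ := post ++ [.jump pre.length])
    (p := pre.length + head.length + body.length + 3)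
    (by simp only [loopProgram, List.append_assoc, List.cons_append, List.nil_append])
    (by simp only [List.length_append, List.length_cons, List.length_nil]; omega) hbody₀
    (execAll head s)
  rw [show pre.length + head.length + body.length + 3 + body₀.length =
      pre.length + head.length + body.length + body₀.length + 3 by omega] at h'
  refine ((h.trans h').trans (reaches_loop_post hpost _)).mono ?_
  rw [length_loopProgram]
  omega

end Loop

theorem execAll_replicate_add {d a : ℕ} (h : d ≠ a) (K : ℕ) (s : Config) :
    execAll (List.replicate K (.add d d a)) s =
      { s with pc := s.pc + K, mem := Function.update s.mem d (s.mem d + K * s.mem a) } := by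
  induction K generalizing s with
  | zero => simp [execAll_nil]
  | succ K ih =>
    rw [List.replicate_succ, execAll_cons, ih]
    simp only [Instr.exec, Function.update_self, Function.update_of_ne h.symm,
      Function.update_idem, Config.mk.injEq, and_true]
    refine ⟨by omega, ?_⟩
    congr 1
    ring

/-- The numbers on which the symbols of a template depend: each symbol of a template is a constant,
or the sum of a constant and one of the following: the number of the first gate of the current
node, of its first child, and of its second child, and the number of the current node. -/
inductive Base
  | zero
  | self
  | fst
  | snd
  | node

/-- The memory cell that holds a base. -/
def Base.cell : Base → ℕ
  | .zero => 9
  | .self => 3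
  | .fst => 4
  | .snd => 5
  | .node => 6

/-- A template for a word. -/
abbrev Template := List (Base × ℕ)

/-- The values of the bases. -/
def baseValue (self fst snd node : ℕ) : Base → ℕ
  | .zero => 0
  | .self => self
  | .fst => fst
  | .snd => snd
  | .node => node

/-- The word described by a template. -/
def Template.fill (F : Template) (val : Base → ℕ) : List ℕ := F.map fun x => val x.1 + x.2

/-- The instructions that write the word described by a template. -/
def emit (F : Template) : Program :=
  F.flatMap fun x => [.const 7 x.2, .add 7 7 x.1.cell, .write 7]

theorem isStraight_emit (F : Template) : ∀ i ∈ emit F, i.IsStraight := by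
  intro i hi
  simp only [emit, List.mem_flatMap, List.mem_cons, List.not_mem_nil, or_false] at hi
  obtain ⟨x, -, rfl | rfl | rfl⟩ := hi <;> exact True.intro

theorem isStraight_replicate_add (K d a : ℕ) :
    ∀ i ∈ List.replicate K (Instr.add d d a), i.IsStraight := by
  intro i hi
  rw [List.eq_of_mem_replicate hi]
  exact True.intro

/-- Writing a template changes only cell `7`, which serves as a scratch cell. -/
theorem execAll_emit (F : Template) (s : Config) :
    ∃ p z, execAll (emit F) s =
      ⟨p, Function.update s.mem 7 z, s.inp, s.out ++ F.fill fun b => s.mem b.cell⟩ := by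
  induction F generalizing s with
  | nil => exact ⟨s.pc, s.mem 7, by simp [emit, execAll_nil, Template.fill]⟩
  | cons x F ih =>
    have hx : x.1.cell ≠ 7 := by cases x.1 <;> simp [Base.cell]
    have : emit (x :: F) = [.const 7 x.2, .add 7 7 x.1.cell, .write 7] ++ emit F := rfl
    rw [this, execAll_append]
    obtain ⟨p, z, h⟩ := ih (execAll [.const 7 x.2, .add 7 7 x.1.cell, .write 7] s)
    refine ⟨p, z, h.trans ?_⟩
    have hF : (Template.fill F fun b => (execAll [.const 7 x.2, .add 7 7 x.1.cell, .write 7] s).mem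
        b.cell) = Template.fill F fun b => s.mem b.cell := by
      have h7 : ∀ b : Base, b.cell ≠ 7 := fun b => by cases b <;> simp [Base.cell]
      simp [execAll_cons, execAll_nil, Instr.exec, h7]
    rw [hF]
    simp [execAll_cons, execAll_nil, Instr.exec, Template.fill, hx, Nat.add_comm]

/-- The two input symbols for the children of a node. -/
def encodeChildren : Option (ℕ × ℕ) → List ℕ
  | none => [0, 0]
  | some (u, v) => [u + 1, v + 1]

/-- The values of the bases for node number `i` with the given children, if there are `K` gates for
each node and one additional gate with number `0`. -/
def nodeValue (K i : ℕ) : Option (ℕ × ℕ) → Base → ℕ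
  | none => baseValue (K * i + 1) 0 0 i
  | some (u, v) => baseValue (K * i + 1) (K * u + 1) (K * v + 1) i

/-- The word written for node number `i`, for a template `F₀` for leaves and a template `F₁` for
internal nodes. -/
def entry (K : ℕ) (F₀ F₁ : Template) (i : ℕ) (c : Option (ℕ × ℕ)) : List ℕ :=
  (match c with
  | none => F₀
  | some _ => F₁).fill (nodeValue K i c)

/-- The words written for a list of nodes, whose numbers start with `i`. -/
def entries (K : ℕ) (F₀ F₁ : Template) : ℕ → List (Option (ℕ × ℕ)) → List ℕ
  | _, [] => []
  | i, c :: cs => entry K F₀ F₁ i c ++ entries K F₀ F₁ (i + 1) cs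

theorem entries_ofFn (K : ℕ) (F₀ F₁ : Template) (i : ℕ) {n : ℕ} (f : Fin n → Option (ℕ × ℕ)) :
    entries K F₀ F₁ i (List.ofFn f) =
      (List.ofFn fun k : Fin n => entry K F₀ F₁ (i + k) (f k)).flatten := by
  induction n generalizing i with
  | zero => rfl
  | succ n ih =>
    rw [List.ofFn_succ, List.ofFn_succ, entries, ih, List.flatten_cons]
    have : ∀ k : Fin n, i + 1 + (k : ℕ) = i + (k.succ : ℕ) := fun k => by
      rw [Fin.val_succ]
      omega
    simp only [this]
    rfl

/-- The contents of the memory cells used by the program `templateProgram`: cell `0` counts the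
nodes still to be processed, cells `3` and `6` hold the first gate and the number of the current
node, and cells `8` and `9` hold `1` and `0`. -/
structure LoopInv (K i r : ℕ) (s : Config) : Prop where
  count : s.mem 0 = r
  self : s.mem 3 = K * i + 1
  node : s.mem 6 = i
  one : s.mem 8 = 1
  zero : s.mem 9 = 0

/-- The part of `templateProgram` before its loop. -/
def templatePre (K : ℕ) (F : Template) : Program :=
  [.read 0, .read 1, .const 8 1, .const 3 1] ++ (List.replicate K (.add 3 3 0) ++
    ([.write 3, .write 9, .const 3 1] ++ (List.replicate K (.add 3 3 1) ++
      (emit F ++ [.const 3 1]))))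

/-- The part of `templateProgram` that starts the processing of a node. -/
def templateHead : Program := [.sub 0 0 8, .read 1, .read 2]

/-- The part of `templateProgram` for internal nodes. -/
def templateBody (K : ℕ) (F₁ : Template) : Program :=
  [.sub 1 1 8, .sub 2 2 8, .const 4 1] ++ (List.replicate K (.add 4 4 1) ++
    ([.const 5 1] ++ (List.replicate K (.add 5 5 2) ++ emit F₁)))

/-- The part of `templateProgram` for leaves. A leaf has no children, so the bases for the children
are set to `0`. -/
def templateBody₀ (F₀ : Template) : Program := [.const 4 0, .const 5 0] ++ emit F₀

/-- The part of `templateProgram` that proceeds to the next node. -/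
def templatePost (K : ℕ) : Program := [.add 6 6 8] ++ List.replicate K (.add 3 3 8)

/-- The program that writes `K * n + 1`, `0` and the word described by `F`, where `n` is the number
of nodes, and then, for each node in turn, the word described by `F₀` if the node is a leaf,
and by `F₁` otherwise. -/
def templateProgram (K : ℕ) (F F₀ F₁ : Template) : Program :=
  loopProgram (templatePre K F) templateHead (templateBody K F₁) (templateBody₀ F₀)
    (templatePost K)

theorem isStraight_templatePre (K : ℕ) (F : Template) : ∀ i ∈ templatePre K F, i.IsStraight := by
  intro i hi
  simp only [templatePre, List.mem_append] at hi
  rcases hi with hi | hi | hi | hi | hi | hi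
  · simp only [List.mem_cons, List.not_mem_nil, or_false] at hi
    rcases hi with rfl | rfl | rfl | rfl <;> exact True.intro
  · exact isStraight_replicate_add _ _ _ _ hi
  · simp only [List.mem_cons, List.not_mem_nil, or_false] at hi
    rcases hi with rfl | rfl | rfl <;> exact True.intro
  · exact isStraight_replicate_add _ _ _ _ hi
  · exact isStraight_emit _ _ hi
  · rw [List.mem_singleton] at hi
    rw [hi]
    exact True.intro

theorem isStraight_templateHead : ∀ i ∈ templateHead, i.IsStraight := by
  intro i hi
  simp only [templateHead, List.mem_cons, List.not_mem_nil, or_false] at hi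
  rcases hi with rfl | rfl | rfl <;> exact True.intro

theorem isStraight_templateBody (K : ℕ) (F₁ : Template) :
    ∀ i ∈ templateBody K F₁, i.IsStraight := by
  intro i hi
  simp only [templateBody, List.mem_append] at hi
  rcases hi with hi | hi | hi | hi | hi
  · simp only [List.mem_cons, List.not_mem_nil, or_false] at hi
    rcases hi with rfl | rfl | rfl <;> exact True.intro
  · exact isStraight_replicate_add _ _ _ _ hi
  · rw [List.mem_singleton] at hi
    rw [hi]
    exact True.intro
  · exact isStraight_replicate_add _ _ _ _ hi
  · exact isStraight_emit _ _ hi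

theorem isStraight_templateBody₀ (F₀ : Template) : ∀ i ∈ templateBody₀ F₀, i.IsStraight := by
  intro i hi
  simp only [templateBody₀, List.mem_append] at hi
  rcases hi with hi | hi
  · simp only [List.mem_cons, List.not_mem_nil, or_false] at hi
    rcases hi with rfl | rfl <;> exact True.intro
  · exact isStraight_emit _ _ hi

theorem isStraight_templatePost (K : ℕ) : ∀ i ∈ templatePost K, i.IsStraight := by
  intro i hi
  simp only [templatePost, List.mem_append] at hi
  rcases hi with hi | hi
  · rw [List.mem_singleton] at hi
    rw [hi]
    exact True.intro
  · exact isStraight_replicate_add _ _ _ _ hi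

theorem execAll_templatePre (K : ℕ) (F : Template) (n root : ℕ) (inp : List ℕ) :
    LoopInv K 0 n (execAll (templatePre K F) (init (n :: root :: inp))) ∧
    (execAll (templatePre K F) (init (n :: root :: inp))).inp = inp ∧
    (execAll (templatePre K F) (init (n :: root :: inp))).out =
      (K * n + 1) :: 0 :: F.fill (baseValue (K * root + 1) 0 0 0) := by
  simp only [templatePre, execAll_append]
  rw [execAll_replicate_add (by simp), execAll_replicate_add (by simp)]
  simp only [execAll_cons, execAll_nil, Instr.exec, init, List.headD_cons, List.tail_cons]
  obtain ⟨p, z, h⟩ := execAll_emit F _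
  rw [h]
  refine ⟨⟨?_, ?_, ?_, ?_, ?_⟩, ?_, ?_⟩
  · simp
  · simp
  · simp
  · simp
  · simp
  · rfl
  · simp only [List.nil_append, List.cons_append]
    refine congr_arg₂ _ (by simp [Nat.add_comm]) (congr_arg₂ _ (by simp) ?_)
    congr 1
    funext b
    cases b <;> simp [Base.cell, baseValue, Nat.add_comm]

theorem execAll_templateBody {K i r u v : ℕ} (F₁ : Template) {inp : List ℕ} {s : Config}
    (hs : LoopInv K i (r + 1) s) (hi : s.inp = (u + 1) :: (v + 1) :: inp) :
    (execAll templateHead s).mem 1 ≠ 0 ∧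
    LoopInv K (i + 1) r
      (execAll (templatePost K) (execAll (templateBody K F₁) (execAll templateHead s))) ∧
    (execAll (templatePost K) (execAll (templateBody K F₁) (execAll templateHead s))).inp = inp ∧
    (execAll (templatePost K) (execAll (templateBody K F₁) (execAll templateHead s))).out =
      s.out ++ F₁.fill (nodeValue K i (some (u, v))) := by
  obtain ⟨h0, h3, h6, h8, h9⟩ := hs
  refine ⟨by simp [templateHead, execAll_cons, execAll_nil, Instr.exec, hi], ?_⟩
  simp only [templatePost, templateBody, templateHead, execAll_append]
  rw [execAll_replicate_add (by simp), execAll_replicate_add (by simp),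
    execAll_replicate_add (by simp)]
  simp only [execAll_cons, execAll_nil, Instr.exec, hi, List.headD_cons, List.tail_cons]
  obtain ⟨p, z, h⟩ := execAll_emit F₁ _
  rw [h]
  refine ⟨⟨?_, ?_, ?_, ?_, ?_⟩, ?_, ?_⟩
  · simp [h0, h8]
  · simp [h3, h8]
    ring
  · simp [h6, h8]
  · simp [h8]
  · simp [h9]
  · rfl
  · simp only
    congr 2
    funext b
    cases b <;> simp [Base.cell, baseValue, nodeValue, h3, h6, h8, h9, Nat.add_comm]

theorem execAll_templateBody₀ {K i r : ℕ} (F₀ : Template) {inp : List ℕ} {s : Config}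
    (hs : LoopInv K i (r + 1) s) (hi : s.inp = 0 :: 0 :: inp) :
    (execAll templateHead s).mem 1 = 0 ∧
    LoopInv K (i + 1) r
      (execAll (templatePost K) (execAll (templateBody₀ F₀) (execAll templateHead s))) ∧
    (execAll (templatePost K) (execAll (templateBody₀ F₀) (execAll templateHead s))).inp = inp ∧
    (execAll (templatePost K) (execAll (templateBody₀ F₀) (execAll templateHead s))).out =
      s.out ++ F₀.fill (nodeValue K i none) := by
  obtain ⟨h0, h3, h6, h8, h9⟩ := hs
  refine ⟨by simp [templateHead, execAll_cons, execAll_nil, Instr.exec, hi], ?_⟩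
  simp only [templatePost, templateBody₀, templateHead, execAll_append]
  rw [execAll_replicate_add (by simp)]
  simp only [execAll_cons, execAll_nil, Instr.exec, hi, List.headD_cons, List.tail_cons]
  obtain ⟨p, z, h⟩ := execAll_emit F₀ _
  rw [h]
  refine ⟨⟨?_, ?_, ?_, ?_, ?_⟩, ?_, ?_⟩
  · simp [h0, h8]
  · simp [h3, h8]
    ring
  · simp [h6, h8]
  · simp [h8]
  · simp [h9]
  · rfl
  · simp only
    congr 2
    funext b
    cases b <;> simp [Base.cell, baseValue, nodeValue, h3, h6, h9]

theorem reaches_templateProgram_loop (K : ℕ) (F F₀ F₁ : Template) (cs : List (Option (ℕ × ℕ)))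
    (i : ℕ) (s : Config) (hs : LoopInv K i cs.length s)
    (hi : s.inp = (cs.map encodeChildren).flatten) :
    ∃ s', Reaches (templateProgram K F F₀ F₁) (s.goto (templatePre K F).length) s'
        ((templateProgram K F F₀ F₁).length * cs.length + 1) ∧
      Halted (templateProgram K F F₀ F₁) s' ∧ s'.out = s.out ++ entries K F₀ F₁ i cs := by
  induction cs generalizing i s with
  | nil =>
    refine ⟨_, (reaches_loop_exit hs.count).mono (by simp), le_rfl, ?_⟩
    simp [entries, Config.goto]
  | cons c cs ih =>
    have h0 : s.mem 0 ≠ 0 := by rw [hs.count]; simp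
    obtain ⟨s₁, h₁, hs₁, hi₁, ho₁⟩ : ∃ s₁ : Config, Reaches (templateProgram K F F₀ F₁)
        (s.goto (templatePre K F).length) (s₁.goto (templatePre K F).length)
        (templateProgram K F F₀ F₁).length ∧ LoopInv K (i + 1) cs.length s₁ ∧
        s₁.inp = (cs.map encodeChildren).flatten ∧ s₁.out = s.out ++ entry K F₀ F₁ i c := by
      rcases c with _ | ⟨u, v⟩
      · have hi' : s.inp = 0 :: 0 :: (cs.map encodeChildren).flatten := by
          rw [hi]; rfl
        obtain ⟨h1, h2⟩ := execAll_templateBody₀ F₀ hs hi'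
        exact ⟨_, reaches_loop_body₀ isStraight_templateHead (isStraight_templateBody₀ F₀)
          (isStraight_templatePost K) h0 h1, h2⟩
      · have hi' : s.inp = (u + 1) :: (v + 1) :: (cs.map encodeChildren).flatten := by
          rw [hi]; rfl
        obtain ⟨h1, h2⟩ := execAll_templateBody F₁ hs hi'
        exact ⟨_, reaches_loop_body isStraight_templateHead (isStraight_templateBody K F₁)
          (isStraight_templatePost K) h0 h1, h2⟩
    obtain ⟨s', h', hh, ho⟩ := ih (i + 1) s₁ hs₁ hi₁
    refine ⟨s', (h₁.trans h').mono ?_, hh, ?_⟩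
    · rw [List.length_cons, Nat.mul_add]
      omega
    · rw [ho, ho₁, List.append_assoc, entries]

/-- The program `templateProgram` runs in linear time. -/
theorem computesInTime_templateProgram (K : ℕ) (F F₀ F₁ : Template) (root : ℕ)
    (cs : List (Option (ℕ × ℕ))) (hcs : 1 ≤ cs.length) :
    ComputesInTime (templateProgram K F F₀ F₁)
      (cs.length :: root :: (cs.map encodeChildren).flatten)
      ((K * cs.length + 1) :: 0 ::
        (F.fill (baseValue (K * root + 1) 0 0 0) ++ entries K F₀ F₁ 0 cs))
      ((2 * (templateProgram K F F₀ F₁).length + 1) * cs.length) := by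
  obtain ⟨h1, h2, h3⟩ := execAll_templatePre K F cs.length root (cs.map encodeChildren).flatten
  obtain ⟨s', h', hh, ho⟩ := reaches_templateProgram_loop K F F₀ F₁ cs 0 _ h1 h2
  obtain ⟨k, hk, rfl⟩ := (reaches_loop_pre (isStraight_templatePre K F) _).trans h'
  refine ⟨k, hk.trans ?_, hh, ?_⟩
  · have h4 : (templatePre K F).length ≤ (templateProgram K F F₀ F₁).length := by
      rw [templateProgram, length_loopProgram]
      omega
    have h5 := Nat.mul_le_mul_left (templateProgram K F F₀ F₁).length hcs
    rw [Nat.add_mul, Nat.mul_assoc, Nat.two_mul]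
    omega
  · refine ho.trans ?_
    rw [h3]
    rfl

end RAM

/-! ### The description of the circuit -/

namespace TreeAutomaton

open RAM

variable {Γ : Type*} {m : ℕ} (A : TreeAutomaton (MSO.Letter Γ 0 m))

instance [Finite Γ] : Finite (LocalGate Γ m A.S) := by
  have := A.finite
  infer_instance

/-- The number of gates for each node. -/
noncomputable def localCount : ℕ := Nat.card (LocalGate Γ m A.S)

/-- The accepting states. -/
noncomputable def accList : List A.S :=
  have := A.finite
  (Set.toFinite A.acc).toFinset.toList

theorem mem_accList {r : A.S} : r ∈ A.accList ↔ r ∈ A.acc := by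
  simp [accList]

theorem nodup_accList : A.accList.Nodup := Finset.nodup_toList _

section Lists

variable [Finite Γ]

/-- A numbering of the gates of a node. -/
noncomputable def localNum : LocalGate Γ m A.S ≃ Fin A.localCount := Finite.equivFin _

/-- The inputs of a gate among the gates of the same node. -/
noncomputable def localInputs (j : LocalGate Γ m A.S) : List (LocalGate Γ m A.S) :=
  (Set.toFinite {j' | A.LocalWire j' j}).toFinset.toList

theorem mem_localInputs {j j' : LocalGate Γ m A.S} :
    j' ∈ A.localInputs j ↔ A.LocalWire j' j := by
  simp [localInputs]

theorem nodup_localInputs (j : LocalGate Γ m A.S) : (A.localInputs j).Nodup :=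
  Finset.nodup_toList _

variable {T : FullTree}

/-- The inputs of a gate among the gates of the children of its node. -/
def childInputs : LocalGate Γ m A.S → Option (T.Node × T.Node) → List (A.Gate T)
  | .prod p q, some (u, v) => [some (u, .state p), some (v, .state q)]
  | _, _ => []

/-- The list of the inputs of a gate. -/
noncomputable def gateInputs : A.Gate T → List (A.Gate T)
  | none => A.accList.map fun r => some (.root T, .state r)
  | some (n, j) =>
    (A.localInputs j).map (fun j' => some (n, j')) ++ A.childInputs j n.children

theorem mem_gateInputs {g g' : A.Gate T} : g' ∈ A.gateInputs g ↔ A.GateWire T g' g := by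
  rcases g with _ | ⟨n, j⟩
  · simp only [gateInputs, List.mem_map, mem_accList]
    constructor
    · rintro ⟨r, hr, rfl⟩
      exact .out r hr
    · intro h
      cases h with
      | out r hr => exact ⟨r, hr, rfl⟩
  · simp only [gateInputs, List.mem_append, List.mem_map, mem_localInputs]
    constructor
    · rintro (⟨j', h, rfl⟩ | h)
      · exact .loc _ _ _ h
      · cases hc : n.children with
        | none => rw [hc] at h; cases j <;> simp [childInputs] at h
        | some c =>
          rw [hc] at h
          cases j <;> simp only [childInputs, List.not_mem_nil, List.mem_cons, or_false] at h
          rcases h with rfl | rfl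
          · exact .fst _ _ _ _ _ hc
          · exact .snd _ _ _ _ _ hc
    · intro h
      cases h with
      | loc _ j' _ h => exact .inl ⟨j', h, rfl⟩
      | fst _ _ _ _ _ h => exact .inr (by simp [h, childInputs])
      | snd _ _ _ _ _ h => exact .inr (by simp [h, childInputs])

theorem nodup_gateInputs (g : A.Gate T) : (A.gateInputs g).Nodup := by
  rcases g with _ | ⟨n, j⟩
  · exact A.nodup_accList.map fun r r' h => by cases h; rfl
  · rw [gateInputs]
    by_cases hj : ∃ p q, j = .prod p q
    · obtain ⟨p, q, rfl⟩ := hj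
      have : A.localInputs (.prod p q) = [] :=
        List.eq_nil_iff_forall_not_mem.2 fun j' h => by cases A.mem_localInputs.1 h
      rw [this]
      cases hc : n.children with
      | none => simp [childInputs]
      | some c =>
        have := FullTree.Node.ne_of_children hc
        simp [childInputs, this]
    · have : A.childInputs j n.children = [] := by
        cases j <;> first | rfl | exact absurd ⟨_, _, rfl⟩ hj
      rw [this, List.append_nil]
      exact (A.nodup_localInputs j).map fun r r' h => by cases h; rfl

end Lists

/-- The template for the description of a gate type. -/
def typeTemplate (labelCode : Γ → ℕ) : HybridGate (Fin m × Unit) (Γ × Unit) → Template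
  | .svar x => [(.zero, 0), (.zero, x.1), (.node, 0)]
  | .bvar b => [(.zero, 1), (.zero, labelCode b.1), (.node, 0)]
  | .union => [(.zero, 2), (.zero, 0), (.zero, 0)]
  | .times => [(.zero, 3), (.zero, 0), (.zero, 0)]
  | .boxtimes => [(.zero, 4), (.zero, 0), (.zero, 0)]
  | .and => [(.zero, 5), (.zero, 0), (.zero, 0)]
  | .or => [(.zero, 6), (.zero, 0), (.zero, 0)]
  | .not => [(.zero, 7), (.zero, 0), (.zero, 0)]

theorem fill_typeTemplate (labelCode : Γ → ℕ) {N : Type*} (num : N → ℕ) (n : N) (leaf : Prop)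
    (j : LocalGate Γ m A.S) {val : Base → ℕ} (h0 : val .zero = 0) (hn : val .node = num n) :
    (typeTemplate labelCode (j.type A.init leaf ())).fill val =
      (j.type A.init leaf n).encode (fun p => ((p.1 : ℕ), num p.2))
        (fun p => (labelCode p.1, num p.2)) := by
  cases j with
  | prod p q =>
    simp only [LocalGate.type]
    split <;> simp [typeTemplate, Template.fill, HybridGate.encode, h0]
  | _ => simp [LocalGate.type, typeTemplate, Template.fill, HybridGate.encode, h0, hn]

variable [Finite Γ]

/-- The template for the inputs of a gate among the gates of the children of its node. -/
noncomputable def childTemplate : LocalGate Γ m A.S → Template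
  | .prod p q => [(.fst, A.localNum (.state p)), (.snd, A.localNum (.state q))]
  | _ => []

/-- The template for the inputs of a gate. -/
noncomputable def inputTemplate (j : LocalGate Γ m A.S) (leaf : Bool) : Template :=
  (A.localInputs j).map (fun j' => (.self, (A.localNum j' : ℕ))) ++
    if leaf then [] else A.childTemplate j

/-- The template for the description of a gate. -/
noncomputable def gateTemplate (labelCode : Γ → ℕ) (leaf : Bool) (j : LocalGate Γ m A.S) :
    Template :=
  typeTemplate labelCode (j.type A.init (leaf = true) ()) ++
    (.zero, (A.inputTemplate j leaf).length) :: A.inputTemplate j leaf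

/-- The template for the descriptions of all gates of a node. -/
noncomputable def nodeTemplate (labelCode : Γ → ℕ) (leaf : Bool) : Template :=
  (List.ofFn fun k => A.gateTemplate labelCode leaf (A.localNum.symm k)).flatten

/-- The template for the description of the output gate. -/
noncomputable def outTemplate : Template :=
  [(.zero, 2), (.zero, 0), (.zero, 0), (.zero, A.accList.length)] ++
    A.accList.map fun r => (.self, (A.localNum (.state r) : ℕ))

variable {T : FullTree} (num : T.Node ≃ Fin T.size)

/-- The numbering of the gates: the output gate has number `0`, and it is followed by the gates of
the first node, the gates of the second node, and so on. -/
noncomputable def gateNum : A.Gate T ≃ Fin (T.size * A.localCount + 1) :=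
  (Equiv.optionCongr ((num.prodCongr A.localNum).trans finProdFinEquiv)).trans
    (finSuccEquiv _).symm

theorem gateNum_none : (A.gateNum num none : ℕ) = 0 := by
  simp [gateNum]

theorem gateNum_some (n : T.Node) (j : LocalGate Γ m A.S) :
    (A.gateNum num (some (n, j)) : ℕ) = A.localCount * num n + 1 + A.localNum j := by
  simp [gateNum]
  omega

/-- The description of a gate. -/
noncomputable def gateWord (labelCode : Γ → ℕ) (g : A.Gate T) : List ℕ :=
  (A.gateType T g).encode (fun p => ((p.1 : ℕ), (num p.2 : ℕ)))
      (fun p => (labelCode p.1, (num p.2 : ℕ))) ++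
    (A.gateInputs g).length :: (A.gateInputs g).map fun g' => (A.gateNum num g' : ℕ)

/-- The numbers of the children of a node. -/
def childNums (n : T.Node) : Option (ℕ × ℕ) :=
  n.children.map fun p => ((num p.1 : ℕ), (num p.2 : ℕ))

theorem fill_inputTemplate (n : T.Node) (j : LocalGate Γ m A.S) :
    (A.inputTemplate j n.children.isNone).fill
        (nodeValue A.localCount (num n) (childNums num n)) =
      (A.gateInputs (some (n, j))).map fun g' => (A.gateNum num g' : ℕ) := by
  simp only [inputTemplate, gateInputs, Template.fill, List.map_append, List.map_map, childNums]
  congr 1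
  · refine List.map_congr_left fun j' _ => ?_
    simp only [Function.comp_apply, gateNum_some]
    cases n.children <;> rfl
  · cases n.children with
    | none => cases j <;> rfl
    | some c => cases j <;> simp [childInputs, childTemplate, gateNum_some, nodeValue, baseValue]

theorem length_inputTemplate (num : T.Node ≃ Fin T.size) (n : T.Node) (j : LocalGate Γ m A.S) :
    (A.inputTemplate j n.children.isNone).length =
      (A.gateInputs (some (n, j))).length := by
  have := congr_arg List.length (A.fill_inputTemplate num n j)
  simpa [Template.fill] using this

theorem fill_gateTemplate (labelCode : Γ → ℕ) (n : T.Node) (j : LocalGate Γ m A.S) :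
    (A.gateTemplate labelCode n.children.isNone j).fill
        (nodeValue A.localCount (num n) (childNums num n)) =
      A.gateWord num labelCode (some (n, j)) := by
  have h0 : nodeValue A.localCount (num n) (childNums num n) .zero = 0 := by
    rw [childNums]
    cases n.children <;> rfl
  have hn : nodeValue A.localCount (num n) (childNums num n) .node = num n := by
    rw [childNums]
    cases n.children <;> rfl
  have h1 := A.fill_inputTemplate num n j
  have h2 := A.fill_typeTemplate labelCode (fun n => (num n : ℕ)) n
    (n.children.isNone = true) j h0 hn
  rw [Template.fill] at h1 h2 ⊢
  rw [gateTemplate, List.map_append, List.map_cons, h1, h2, h0, A.length_inputTemplate num,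
    Nat.zero_add]
  simp only [gateWord, gateType, Option.isNone_iff_eq_none]

theorem entry_eq (labelCode : Γ → ℕ) (n : T.Node) :
    entry A.localCount (A.nodeTemplate labelCode true) (A.nodeTemplate labelCode false) (num n)
        (childNums num n) =
      (List.ofFn fun k => A.gateWord num labelCode
        (some (n, A.localNum.symm k))).flatten := by
  have : entry A.localCount (A.nodeTemplate labelCode true) (A.nodeTemplate labelCode false)
      (num n) (childNums num n) = (A.nodeTemplate labelCode n.children.isNone).fill
        (nodeValue A.localCount (num n) (childNums num n)) := by
    simp only [entry, childNums]
    cases n.children <;> rfl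
  rw [this, nodeTemplate, Template.fill, List.map_flatten, List.map_ofFn]
  congr 2
  funext k
  exact A.fill_gateTemplate num labelCode n _

theorem fill_outTemplate (labelCode : Γ → ℕ) :
    A.outTemplate.fill (baseValue (A.localCount * num (.root T) + 1) 0 0 0) =
      A.gateWord num labelCode none := by
  simp [outTemplate, gateWord, gateType, gateInputs, Template.fill, baseValue,
    HybridGate.encode, gateNum_some]

theorem gateNum_symm_zero : (A.gateNum num).symm 0 = none := by
  rw [Equiv.symm_apply_eq]
  exact Fin.ext (A.gateNum_none num).symm

theorem gateNum_symm_succ (k : Fin T.size) (l : Fin A.localCount)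
    (h : (k : ℕ) * A.localCount + l < T.size * A.localCount) :
    (A.gateNum num).symm (Fin.succ ⟨k * A.localCount + l, h⟩) =
      some (num.symm k, A.localNum.symm l) := by
  rw [Equiv.symm_apply_eq]
  refine Fin.ext ?_
  rw [gateNum_some, Equiv.apply_symm_apply, Equiv.apply_symm_apply, Fin.val_succ,
    Nat.mul_comm A.localCount]
  exact Nat.add_right_comm _ _ _

theorem flatten_gateWord (labelCode : Γ → ℕ) :
    (List.ofFn fun g => A.gateWord num labelCode ((A.gateNum num).symm g)).flatten =
      A.gateWord num labelCode none ++
        entries A.localCount (A.nodeTemplate labelCode true) (A.nodeTemplate labelCode false) 0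
          (List.ofFn fun k => childNums num (num.symm k)) := by
  rw [List.ofFn_succ, List.flatten_cons, gateNum_symm_zero, entries_ofFn, List.ofFn_mul,
    List.flatten_flatten, List.map_ofFn]
  congr 3
  funext k
  have := A.entry_eq num labelCode (num.symm k)
  rw [Equiv.apply_symm_apply] at this
  rw [Nat.zero_add, this, Function.comp_apply]
  congr 2
  funext l
  rw [gateNum_symm_succ]

theorem isEncodedBy_rename_circuit (labelCode : Γ → ℕ) :
    ((A.circuit T).rename (A.gateNum num)).IsEncodedBy (fun p => ((p.1 : ℕ), (num p.2 : ℕ)))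
      (fun p => (labelCode p.1, (num p.2 : ℕ)))
      ((A.localCount * T.size + 1) :: 0 ::
        (A.outTemplate.fill (baseValue (A.localCount * num (.root T) + 1) 0 0 0) ++
          entries A.localCount (A.nodeTemplate labelCode true) (A.nodeTemplate labelCode false) 0
            (List.ofFn fun k => childNums num (num.symm k)))) := by
  refine ⟨fun g => (A.gateInputs ((A.gateNum num).symm g)).map (A.gateNum num),
    fun g => ⟨(A.nodup_gateInputs _).map (A.gateNum num).injective, fun g' => ?_⟩, ?_⟩
  · rw [List.mem_map]
    constructor
    · rintro ⟨g', h, rfl⟩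
      have := A.mem_gateInputs.1 h
      rw [← (A.gateNum num).symm_apply_apply g'] at this
      exact this
    · intro h
      exact ⟨_, A.mem_gateInputs.2 h, (A.gateNum num).apply_symm_apply g'⟩
  · rw [A.fill_outTemplate num labelCode, ← A.flatten_gateWord num labelCode, Nat.mul_comm]
    refine congr_arg₂ _ rfl (congr_arg₂ _ (A.gateNum_none num).symm ?_)
    congr 2
    funext g
    -- The coercion in `IsEncodedBy` is elaborated as a monadic map over the list of inputs.
    have hl : ∀ l : List (Fin (T.size * A.localCount + 1)),
        (List.map (fun g' => g') do
          let a ← l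
          pure (a : ℕ)) = l.map Fin.val := fun l => by
      simp [List.map_eq_flatMap]
    rw [gateWord, List.length_map, hl, List.map_map]
    rfl

end TreeAutomaton

theorem FullTree.one_le_size (T : FullTree) : 1 ≤ T.size := by
  cases T <;> simp [FullTree.size]

theorem FullTree.encode_eq (T : FullTree) (num : T.Node ≃ Fin T.size) :
    T.encode num = T.size :: (num (.root T) : ℕ) ::
      ((List.ofFn fun k => TreeAutomaton.childNums num (num.symm k)).map
        RAM.encodeChildren).flatten := by
  rw [FullTree.encode, List.map_ofFn]
  congr 4
  funext k
  simp only [Function.comp_apply, TreeAutomaton.childNums]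
  cases (num.symm k).children <;> rfl

theorem mainTheorem3 {Γ : Type*} [Finite Γ] (labelCode : Γ ↪ ℕ) {m : ℕ} (Q : MSO Γ 0 m) :
    ∃ (P : RAM.Program) (cTime cFanIn cDep : ℕ),
      ∀ (T : FullTree) (num : T.Node ≃ Fin T.size),
        ∃ (w : List ℕ) (N : ℕ)
          (C : HybridCircuit (Fin N) (Fin m × T.Node) (Γ × T.Node)),
          RAM.ComputesInTime P (T.encode num) w (cTime * T.size) ∧
          C.IsEncodedBy (fun p => ((p.1 : ℕ), (num p.2 : ℕ)))
            (fun p => (labelCode p.1, (num p.2 : ℕ))) w ∧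
          C.IsProvenanceCircuit Q ∧
          C.IsDDNNF ∧
          C.IsUpwardsDeterministic ∧
          C.maxFanIn ≤ cFanIn ∧
          C.dependencySize ≤ cDep * (T.height + 1) := by
  obtain ⟨A, hA⟩ := Q.exists_automaton
  refine ⟨RAM.templateProgram A.localCount A.outTemplate (A.nodeTemplate labelCode true)
    (A.nodeTemplate labelCode false), 2 * (RAM.templateProgram A.localCount A.outTemplate
      (A.nodeTemplate labelCode true) (A.nodeTemplate labelCode false)).length + 1,
    A.localCount + 2, A.localCount + 1, fun T num =>
    ⟨_, _, (A.circuit T).rename (A.gateNum num), ?_, A.isEncodedBy_rename_circuit num labelCode,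
      HybridCircuit.isProvenanceCircuit_rename _ (A.isProvenanceCircuit_circuit T hA),
      HybridCircuit.isDDNNF_rename _ A.isDDNNF_circuit,
      HybridCircuit.isUpwardsDeterministic_rename _ A.isUpwardsDeterministic_circuit,
      ((A.circuit T).toCircuit.maxFanIn_rename _).trans_le (A.maxFanIn_circuit_le T),
      ((A.circuit T).toCircuit.dependencySize_rename _).trans_le
        (A.dependencySize_circuit_le T)⟩⟩
  have h := RAM.computesInTime_templateProgram A.localCount A.outTemplate
    (A.nodeTemplate labelCode true) (A.nodeTemplate labelCode false) (num (.root T))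
    (List.ofFn fun k => TreeAutomaton.childNums num (num.symm k))
    (by rw [List.length_ofFn]; exact T.one_le_size)
  rw [List.length_ofFn] at h
  rw [T.encode_eq num]
  exact h
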